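/- Let $\bar X=(X_0,X_1)$ and $\bar Y=(Y_0,Y_1)$ be compatible pairs of Banach spaces over $\mathbb K\in\{\mathbb R,\mathbb C\}$, let $0<\theta<1$ and $1\le q\le\infty$. For $t>0$ and $x\in X_0\cap X_1$ put $J(t,x;\bar X)=\max\{\|x\|_{X_0},t\|x\|_{X_1}\}$, and put $\Phi_{\theta,q}(h)=\left\{\int_0^\infty (s^{-\theta}|h(s)|)^q\frac{ds}{s}\right\}^{1/q}$ (the essential supremum of $s^{-\theta}|h(s)|$ if $q=\infty$). The space $\bar X_{\theta,q}$ consists of the $f\in X_0+X_1$ that can be written as $f=\int_0^\infty u(s)\frac{ds}{s}$, with $u:(0,\infty)\to X_0\cap X_1$ strongly measurable, the integral convergent in $X_0+X_1$, and $\Phi_{\theta,q}(J(s,u(s);\bar X))<\infty$; $\|f\|_{\bar X_{\theta,q}}$ is the infimum of $\Phi_{\theta,q}(J(s,u(s);\bar X))$ over all such $u$. For each $f\in\bar X_{\theta,q}$ choose a representation $f=\int_0^\infty u_f(s)\frac{ds}{s}$ of this kind with $\Phi_{\theta,q}(J(s,u_f(s);\bar X))\le 2\|f\|_{\bar X_{\theta,q}}$,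 and make a choice of the same kind for $\bar Y$. For a scalar function $g$ on $(0,\infty)$ and $n=0,1,2,\dots$ let $$\Omega_{n,g}f=\frac1{n!}\int_0^\infty u_f(s)\,g(s)^n\,\frac{ds}{s}.$$ For $w:(0,\infty)\to\mathbb K$ integrable on every interval $(0,t]$ let $Pw(t)=\frac1t\int_0^t w(s)\,ds$, and let $W$ be the class of such $w$ for which $\|w\|_W=\|Pw-w\|_{L^\infty(0,\infty)}<\infty$. Let $T:\bar X\to\bar Y$ be a bounded linear operator, that is, a linear map $X_0+X_1\to Y_0+Y_1$ that restricts to bounded operators $X_j\to Y_j$ ($j=0,1$), with $\|T\|=\max_j\|T\|_{X_j\to Y_j}$. Define $C_{0,g}f=Tf$ and, for $n\ge1$, $$C_{n,g}f=T(\Omega_{n,g}f)-\Omega_{n,g}(Tf)-\sum_{j=1}^{n-1}\Omega_{j,g}(C_{n-j,g}f).$$ **Theorem.** For every $n\ge0$ there is a constant $c$, depending only on $n$, $\theta$, $q$ (and $\mathbb K$), such that for all $\bar X,\bar Y$, $T$, all choices $f\mapsto u_f$ as above, all $w\in W$ and each of $g=w$ and $g=Pw$: the integrals defining $\Omega_{k,g}$,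 $k\ge0$, on $\bar X_{\theta,q}$ and on $\bar Y_{\theta,q}$ converge absolutely in $X_0+X_1$ and $Y_0+Y_1$ respectively, and $C_{n,g}$ maps $\bar X_{\theta,q}$ to $\bar Y_{\theta,q}$ with $$\|C_{n,g}f\|_{\bar Y_{\theta,q}}\le c\,\|T\|\,\|w\|_W^{\,n}\,\|f\|_{\bar X_{\theta,q}}\qquad(f\in\bar X_{\theta,q}).$$ -/

import Mathlib

open MeasureTheory Set
open scoped ENNReal NNReal

universe u u' v

noncomputable section

/-- A compatible pair of Banach spaces over `𝕜`: two Banach spaces, both continuously and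
injectively embedded in a common Hausdorff topological vector space `V`. -/
structure BanachPair (𝕜 : Type v) [RCLike 𝕜] where
  X₀ : Type u
  X₁ : Type u
  V : Type u
  [normed₀ : NormedAddCommGroup X₀]
  [space₀ : NormedSpace 𝕜 X₀]
  [complete₀ : CompleteSpace X₀]
  [normed₁ : NormedAddCommGroup X₁]
  [space₁ : NormedSpace 𝕜 X₁]
  [complete₁ : CompleteSpace X₁]
  [groupV : AddCommGroup V]
  [moduleV : Module 𝕜 V]
  [topV : TopologicalSpace V]
  [topGroupV : IsTopologicalAddGroup V]
  [contSMulV : ContinuousSMul 𝕜 V]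
  [t2V : T2Space V]
  i₀ : X₀ →L[𝕜] V
  i₁ : X₁ →L[𝕜] V
  inj₀ : Function.Injective i₀
  inj₁ : Function.Injective i₁

attribute [instance] BanachPair.normed₀ BanachPair.space₀ BanachPair.complete₀
  BanachPair.normed₁ BanachPair.space₁ BanachPair.complete₁ BanachPair.groupV
  BanachPair.moduleV BanachPair.topV BanachPair.topGroupV BanachPair.contSMulV
  BanachPair.t2V

namespace BanachPair

variable {𝕜 : Type v} [RCLike 𝕜]

/-- The intersection `X₀ ∩ X₁`, realized as the pairs `(x₀, x₁)` whose components are the same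
element of `V`; its norm is `max ‖x‖_{X₀} ‖x‖_{X₁}`. -/
abbrev Inter (X : BanachPair.{u, v} 𝕜) : Submodule 𝕜 (X.X₀ × X.X₁) :=
  LinearMap.eqLocus (X.i₀.comp (ContinuousLinearMap.fst 𝕜 X.X₀ X.X₁)).toLinearMap
    (X.i₁.comp (ContinuousLinearMap.snd 𝕜 X.X₀ X.X₁)).toLinearMap

/-- The pairs `(x₀, x₁)` with `x₀ + x₁ = 0` in `V`. -/
abbrev sumKer (X : BanachPair.{u, v} 𝕜) : Submodule 𝕜 (X.X₀ × X.X₁) :=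
  LinearMap.ker (X.i₀.coprod X.i₁).toLinearMap

instance isClosed_sumKer (X : BanachPair.{u, v} 𝕜) :
    IsClosed (X.sumKer : Set (X.X₀ × X.X₁)) :=
  (X.i₀.coprod X.i₁).isClosed_ker

/-- The sum `X₀ + X₁`: since `(x₀, x₁) ↦ x₀ + x₁` identifies it with the quotient of `X₀ × X₁` by
`sumKer`, it is given the quotient norm, `inf {max ‖x₀‖ ‖x₁‖ : f = x₀ + x₁}`, which is equivalent
to `inf {‖x₀‖ + ‖x₁‖ : f = x₀ + x₁}`. Only its topology is used below. -/
def Sum (X : BanachPair.{u, v} 𝕜) : Type u := (X.X₀ × X.X₁) ⧸ X.sumKer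

instance (X : BanachPair.{u, v} 𝕜) : NormedAddCommGroup X.Sum :=
  inferInstanceAs (NormedAddCommGroup ((X.X₀ × X.X₁) ⧸ X.sumKer))

instance (X : BanachPair.{u, v} 𝕜) : NormedSpace 𝕜 X.Sum :=
  inferInstanceAs (NormedSpace 𝕜 ((X.X₀ × X.X₁) ⧸ X.sumKer))

instance (X : BanachPair.{u, v} 𝕜) : NormedSpace ℝ X.Sum :=
  NormedSpace.restrictScalars ℝ 𝕜 X.Sum

instance (X : BanachPair.{u, v} 𝕜) : IsScalarTower ℝ 𝕜 X.Sum :=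
  IsScalarTower.restrictScalars ℝ 𝕜 X.Sum

instance (X : BanachPair.{u, v} 𝕜) : CompleteSpace X.Sum :=
  inferInstanceAs (CompleteSpace ((X.X₀ × X.X₁) ⧸ X.sumKer))

/-- The map `(x₀, x₁) ↦ x₀ + x₁` onto `X₀ + X₁`. -/
def addMap (X : BanachPair.{u, v} 𝕜) : (X.X₀ × X.X₁) →ₗ[𝕜] X.Sum := X.sumKer.mkQ

/-- The inclusion of `X₀` in `X₀ + X₁`. -/
def incl₀ (X : BanachPair.{u, v} 𝕜) : X.X₀ →ₗ[𝕜] X.Sum :=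
  X.addMap ∘ₗ LinearMap.inl 𝕜 X.X₀ X.X₁

/-- The inclusion of `X₁` in `X₀ + X₁`. -/
def incl₁ (X : BanachPair.{u, v} 𝕜) : X.X₁ →ₗ[𝕜] X.Sum :=
  X.addMap ∘ₗ LinearMap.inr 𝕜 X.X₀ X.X₁

/-- The inclusion of `X₀ ∩ X₁` in `X₀ + X₁`. -/
def inclInter (X : BanachPair.{u, v} 𝕜) : X.Inter →ₗ[𝕜] X.Sum :=
  X.incl₀ ∘ₗ LinearMap.fst 𝕜 X.X₀ X.X₁ ∘ₗ X.Inter.subtype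

/-- `J(t, x) = max {‖x‖_{X₀}, t ‖x‖_{X₁}}` on `X₀ ∩ X₁`. -/
def J (X : BanachPair.{u, v} 𝕜) (t : ℝ) (x : X.Inter) : ℝ :=
  max ‖x.1.1‖ (t * ‖x.1.2‖)

end BanachPair

/-- The measure `ds/s` on `(0, ∞)`. -/
def dsOverS : Measure ℝ :=
  (volume.restrict (Ioi (0 : ℝ))).withDensity fun s => ENNReal.ofReal s⁻¹

/-- `Φ_{θ,q}(g) = (∫₀^∞ (s^{-θ} |g(s)|)^q ds/s)^{1/q}`, the essential supremum of
`s^{-θ} |g(s)|` if `q = ∞`. -/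
def Phi (θ : ℝ) (q : ℝ≥0∞) (g : ℝ → ℝ) : ℝ≥0∞ :=
  eLpNorm (fun s => s ^ (-θ) * g s) q dsOverS

namespace BanachPair

variable {𝕜 : Type v} [RCLike 𝕜]

/-- `f = ∫₀^∞ u(s) ds/s`, with `u : (0, ∞) → X₀ ∩ X₁` strongly measurable and the integral
convergent in `X₀ + X₁`. -/
structure IsRep (X : BanachPair.{u, v} 𝕜) (a : ℝ → X.Inter) (f : X.Sum) : Prop where
  aestronglyMeasurable : AEStronglyMeasurable a dsOverS
  integrable : Integrable (fun s => X.inclInter (a s)) dsOverS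
  integral_eq : ∫ s, X.inclInter (a s) ∂dsOverS = f

/-- The real interpolation space `(X₀, X₁)_{θ,q}` of the `J`-method. -/
def interpSpace (X : BanachPair.{u, v} 𝕜) (θ : ℝ) (q : ℝ≥0∞) : Set X.Sum :=
  {f | ∃ a : ℝ → X.Inter, X.IsRep a f ∧ Phi θ q (fun s => X.J s (a s)) < ∞}

/-- The norm of `(X₀, X₁)_{θ,q}` (equal to `∞` outside the space). -/
def interpNorm (X : BanachPair.{u, v} 𝕜) (θ : ℝ) (q : ℝ≥0∞) (f : X.Sum) : ℝ≥0∞ :=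
  ⨅ (a : ℝ → X.Inter) (_ : X.IsRep a f), Phi θ q (fun s => X.J s (a s))

/-- A choice `f ↦ u_f` of nearly optimal representations of the elements of `(X₀, X₁)_{θ,q}`. -/
structure NearOptimal (X : BanachPair.{u, v} 𝕜) (θ : ℝ) (q : ℝ≥0∞) where
  rep : X.Sum → ℝ → X.Inter
  isRep : ∀ f ∈ X.interpSpace θ q, X.IsRep (rep f) f
  phi_le : ∀ f ∈ X.interpSpace θ q,
    Phi θ q (fun s => X.J s (rep f s)) ≤ 2 * X.interpNorm θ q f

/-- `Ω_{n,w} f = (1/n!) ∫₀^∞ u_f(s) w(s)^n ds/s`, an element of `X₀ + X₁`. -/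
def Omega {X : BanachPair.{u, v} 𝕜} {θ : ℝ} {q : ℝ≥0∞} (U : X.NearOptimal θ q)
    (n : ℕ) (w : ℝ → 𝕜) (f : X.Sum) : X.Sum :=
  ((n.factorial : 𝕜)⁻¹) • ∫ s, (w s) ^ n • X.inclInter (U.rep f s) ∂dsOverS

/-- A bounded linear operator `T : (X₀, X₁) → (Y₀, Y₁)`: a linear map of `X₀ + X₁` to `Y₀ + Y₁`
that restricts to bounded operators `X₀ → Y₀` and `X₁ → Y₁`. -/
structure Hom (X : BanachPair.{u, v} 𝕜) (Y : BanachPair.{u', v} 𝕜) where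
  onSum : X.Sum →ₗ[𝕜] Y.Sum
  T₀ : X.X₀ →L[𝕜] Y.X₀
  T₁ : X.X₁ →L[𝕜] Y.X₁
  restrict₀ : ∀ x, onSum (X.incl₀ x) = Y.incl₀ (T₀ x)
  restrict₁ : ∀ x, onSum (X.incl₁ x) = Y.incl₁ (T₁ x)

/-- `‖T‖ = max {‖T‖_{X₀ → Y₀}, ‖T‖_{X₁ → Y₁}}`. -/
def Hom.opNorm {X : BanachPair.{u, v} 𝕜} {Y : BanachPair.{u', v} 𝕜} (T : X.Hom Y) : ℝ≥0 := max ‖T.T₀‖₊ ‖T.T₁‖₊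

/-- The commutators: `C_{0,w} f = T f` and, for `n ≥ 1`,
`C_{n,w} f = [T, Ω_{n,w}] f - ∑_{j=1}^{n-1} Ω_{j,w} (C_{n-j,w} f)`, where
`[T, Ω_{n,w}] f = T (Ω_{n,w} f) - Ω_{n,w} (T f)`. -/
def commutator {X : BanachPair.{u, v} 𝕜} {Y : BanachPair.{u', v} 𝕜}
    {θ : ℝ} {q : ℝ≥0∞} (T : X.Hom Y) (UX : X.NearOptimal θ q) (UY : Y.NearOptimal θ q)
    (w : ℝ → 𝕜) : ℕ → X.Sum → Y.Sum
  | 0, f => T.onSum f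
  | n + 1, f =>
      (T.onSum (Omega UX (n + 1) w f) - Omega UY (n + 1) w (T.onSum f))
        - ∑ j : Fin n, Omega UY (j + 1) w (commutator T UX UY w (n - j) f)
  termination_by n => n
  decreasing_by omega

end BanachPair

/-- `Pw(t) = (1/t) ∫₀^t w(s) ds`. -/
def hardyP {𝕜 : Type v} [RCLike 𝕜] (w : ℝ → 𝕜) (t : ℝ) : 𝕜 :=
  t⁻¹ • ∫ s in Ioc 0 t, w s

/-- The class `W`: `w` is integrable on each `(0, t]`, so that `Pw` is defined, and `Pw - w` is in
`L^∞(0, ∞)`. -/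
def MemW {𝕜 : Type v} [RCLike 𝕜] (w : ℝ → 𝕜) : Prop :=
  (∀ t : ℝ, 0 < t → IntegrableOn w (Ioc 0 t)) ∧
    MemLp (fun t => hardyP w t - w t) ∞ (volume.restrict (Ioi (0 : ℝ)))

/-- `‖w‖_W = ‖Pw - w‖_{L^∞(0, ∞)}`. -/
def normW {𝕜 : Type v} [RCLike 𝕜] (w : ℝ → 𝕜) : ℝ≥0∞ :=
  eLpNorm (fun t => hardyP w t - w t) ∞ (volume.restrict (Ioi (0 : ℝ)))

end

/-! Since `Ω_0` is the identity on the interpolation space, the recursion for the commutators says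
`T Ω_m f = ∑_{k≤m} Ω_{m-k}(C_k f)` (`commutator_eq`). Let `a_k = [k = 0] T u_f - [k < n] u_{C_k f}`.
Then the convolved moments `∑_{k+j=m} (1/j!) ∫ a_k g^j ds/s` vanish for `m < n` and give `C_n f` for
`m = n`. The theorem becomes a cancellation statement about one sequence of functions, and no
linearity of `f ↦ u_f` is needed.

For `g = Pw` the moment of order 0 says `∫ a_0 ds/s = 0`. Hence `V(t) = ∫_0^t a_0 ds/s = -∫_t^∞ a_0
ds/s` lies in the intersection: the first form converges in the space of index 0, the second in that
of index 1. `J(t, V(t))` is at most the Calderón operator applied to `J(s, a_0(s))`, so Hardy's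
inequalities control `V` (`PhiBound.exists_primitive`). As `t (Pw)' = w - Pw`, integration by parts
turns the moment of order `j + 1` of `a_0` into the moment of order `j` of `(Pw - w) V`, at the cost
of one factor `‖w‖_W` (`PhiBound.exists_cancellation`). Adding `(Pw - w) V` to `a_1` and shifting
indices leaves one vanishing condition fewer; after `n` rounds `C_n f` is the integral of a single
controlled function (`exists_rep_of_moments_eq_zero`).

For general `g` at bounded distance from `Pw`, factor `e^{zg} = e^{z(g - Pw)} e^{zPw}`: the first
factor has bounded coefficients in `z` and is absorbed into the `a_k`. All integrals converge
because `Pw` grows at most logarithmically, and powers of the logarithm cost only a small change of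
`θ`. -/

noncomputable section

/-! ### Absolute continuity and the fundamental theorem for scalar functions. -/

section FundamentalTheorem

variable {𝕜 : Type v} [RCLike 𝕜]

theorem absolutelyContinuousOnInterval_const {E : Type*} [PseudoMetricSpace E] (x : E) (a b : ℝ) :
    AbsolutelyContinuousOnInterval (fun _ : ℝ => x) a b :=
  (LipschitzWith.const x).lipschitzOnWith.absolutelyContinuousOnInterval

/-- Real and imaginary parts are treated separately and recombined as `re • 1 + im • I`. -/
theorem absolutelyContinuousOnInterval_intervalIntegral_rclike {f : ℝ → 𝕜} {a b c d : ℝ}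
    (hf : IntervalIntegrable f volume c d) (hab : uIcc a b ⊆ uIcc c d) :
    AbsolutelyContinuousOnInterval (fun x => ∫ t in c..x, f t) a b := by
  have hc : c ∈ uIcc c d := left_mem_uIcc
  have key : ∀ φ : 𝕜 →L[ℝ] ℝ, ∀ e : 𝕜,
      AbsolutelyContinuousOnInterval (fun x => (∫ t in c..x, φ (f t)) • e) c d := fun φ e =>
    (IntervalIntegrable.absolutelyContinuousOnInterval_intervalIntegral
      (f := fun t => φ (f t)) (by
        rw [intervalIntegrable_iff] at hf ⊢
        exact φ.integrable_comp hf) hc).smul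
      (absolutelyContinuousOnInterval_const e c d)
  refine AbsolutelyContinuousOnInterval.mono ?_ hab
  have h := (key RCLike.reCLM 1).add (key RCLike.imCLM RCLike.I)
  rw [absolutelyContinuousOnInterval_iff] at h ⊢
  intro ε hε
  obtain ⟨δ, hδ, H⟩ := h ε hε
  refine ⟨δ, hδ, fun E hE hlt => ?_⟩
  refine lt_of_eq_of_lt (Finset.sum_congr rfl fun i hi => ?_) (H E hE hlt)
  have mem := hE.1 i hi
  have aux : ∀ x ∈ uIcc c d, (∫ t in c..x, f t) =
      (∫ t in c..x, RCLike.reCLM (f t)) • (1 : 𝕜) +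
        (∫ t in c..x, RCLike.imCLM (f t)) • RCLike.I := by
    intro x hx
    have hfx : IntervalIntegrable f volume c x := hf.mono_set (uIcc_subset_uIcc hc hx)
    rw [ContinuousLinearMap.intervalIntegral_comp_comm _ hfx,
      ContinuousLinearMap.intervalIntegral_comp_comm _ hfx]
    conv_lhs => rw [← RCLike.re_add_im (∫ t in c..x, f t)]
    simp [RCLike.real_smul_eq_coe_mul]
  simp only [Pi.add_apply]
  rw [aux _ mem.1, aux _ mem.2]

/-- Subtracting the indefinite integral of `f'` leaves an absolutely continuous function with
derivative zero almost everywhere, hence a constant. -/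
theorem AbsolutelyContinuousOnInterval.integral_eq_sub_of_ae_hasDerivAt {f f' : ℝ → 𝕜} {a b : ℝ}
    (hf : AbsolutelyContinuousOnInterval f a b) (hf' : IntervalIntegrable f' volume a b)
    (hd : ∀ᵐ x, x ∈ uIcc a b → HasDerivAt f (f' x) x) :
    ∫ x in a..b, f' x = f b - f a := by
  have hac : AbsolutelyContinuousOnInterval (fun x => f x - ∫ t in a..x, f' t) a b :=
    hf.sub (absolutelyContinuousOnInterval_intervalIntegral_rclike hf' le_rfl)
  obtain ⟨C, hC⟩ := hac.const_of_ae_hasDerivAt_zero (by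
    filter_upwards [hd, hf'.ae_hasDerivAt_integral] with x h1 h2 hx
    simpa using (h1 hx).fun_sub (h2 hx a (by simp)))
  have h1 := hC a (by simp)
  have h2 := hC b (by simp)
  simp only [intervalIntegral.integral_same, sub_zero] at h1
  rw [h1, ← h2]
  abel

theorem AbsolutelyContinuousOnInterval.pow_rclike {f : ℝ → 𝕜} {a b : ℝ}
    (hf : AbsolutelyContinuousOnInterval f a b) (n : ℕ) :
    AbsolutelyContinuousOnInterval (fun x => f x ^ n) a b := by
  induction n with
  | zero => simpa using absolutelyContinuousOnInterval_const (1 : 𝕜) a b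
  | succ n ih => simpa [pow_succ, smul_eq_mul] using ih.fun_smul hf

end FundamentalTheorem

/-! ### The averages `Pw`: derivative and logarithmic growth. -/

section Hardy

variable {𝕜 : Type v} [RCLike 𝕜] {w : ℝ → 𝕜}

theorem MemW.intervalIntegrable (hw : MemW w) {a b : ℝ} (ha : 0 ≤ a) (hb : 0 ≤ b) :
    IntervalIntegrable w volume a b := by
  rw [intervalIntegrable_iff]
  have h1 := hw.1 (max a b + 1) (by positivity)
  refine h1.mono_set fun x hx => ?_
  rw [uIoc, mem_Ioc] at hx
  exact ⟨lt_of_le_of_lt (le_min ha hb) hx.1, by linarith [hx.2]⟩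

theorem hardyP_eq_intervalIntegral (w : ℝ → 𝕜) {t : ℝ} (ht : 0 ≤ t) :
    hardyP w t = t⁻¹ • ∫ s in (0 : ℝ)..t, w s := by
  rw [hardyP, intervalIntegral.integral_of_le ht]

theorem pos_of_mem_uIcc {a b x : ℝ} (ha : 0 < a) (hb : 0 < b) (hx : x ∈ uIcc a b) : 0 < x :=
  (lt_min ha hb).trans_le hx.1

/-- Away from 0, `Pw` is the product of the smooth `x⁻¹` and a primitive of `w`. As `w` is merely
integrable, nothing better than absolute continuity can be used in the integration by parts. -/
theorem MemW.absolutelyContinuousOnInterval_hardyP (hw : MemW w) {a b : ℝ} (ha : 0 < a)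
    (hb : 0 < b) : AbsolutelyContinuousOnInterval (hardyP w) a b := by
  have hF : AbsolutelyContinuousOnInterval (fun x => ∫ s in (0 : ℝ)..x, w s) a b :=
    absolutelyContinuousOnInterval_intervalIntegral_rclike (d := max a b)
      (hw.intervalIntegrable le_rfl (ha.le.trans (le_max_left _ _))) (by
        rw [uIcc_of_le (ha.le.trans (le_max_left a b))]
        exact fun x hx => ⟨(pos_of_mem_uIcc ha hb hx).le, hx.2⟩)
  have hinv : AbsolutelyContinuousOnInterval (fun x : ℝ => x⁻¹) a b := by
    refine ContDiffOn.absolutelyContinuousOnInterval ?_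
    exact contDiffOn_id.inv fun x hx => (pos_of_mem_uIcc ha hb hx).ne'
  have h := hinv.fun_smul hF
  rw [absolutelyContinuousOnInterval_iff] at h ⊢
  intro ε hε
  obtain ⟨δ, hδ, H⟩ := h ε hε
  refine ⟨δ, hδ, fun E hE hlt => ?_⟩
  refine lt_of_eq_of_lt (Finset.sum_congr rfl fun i hi => ?_) (H E hE hlt)
  have mem := hE.1 i hi
  rw [hardyP_eq_intervalIntegral w (pos_of_mem_uIcc ha hb mem.1).le,
    hardyP_eq_intervalIntegral w (pos_of_mem_uIcc ha hb mem.2).le]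

theorem MemW.ae_hasDerivAt_hardyP (hw : MemW w) {a b : ℝ} (ha : 0 < a) (hb : 0 < b) :
    ∀ᵐ x, x ∈ uIcc a b → HasDerivAt (hardyP w) (x⁻¹ • (w x - hardyP w x)) x := by
  have h0 : (0 : ℝ) ≤ max a b := ha.le.trans (le_max_left a b)
  filter_upwards [(hw.intervalIntegrable le_rfl h0).ae_hasDerivAt_integral] with x h hx
  have hx0 := pos_of_mem_uIcc ha hb hx
  have hF := h (by rw [uIcc_of_le h0]; exact ⟨hx0.le, hx.2⟩) 0 (by simp)
  have hG := (hasDerivAt_inv hx0.ne').smul hF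
  have : HasDerivAt (hardyP w) (x⁻¹ • w x + (-(x ^ 2)⁻¹) • ∫ s in (0 : ℝ)..x, w s) x := by
    refine hG.congr_of_eventuallyEq ?_
    filter_upwards [lt_mem_nhds hx0] with y hy
    simp [hardyP_eq_intervalIntegral w hy.le]
  convert this using 1
  rw [hardyP_eq_intervalIntegral w hx0.le, smul_sub, smul_smul, sub_eq_add_neg, ← neg_smul]
  congr 3
  ring

theorem MemW.continuousOn_hardyP (hw : MemW w) : ContinuousOn (hardyP w) (Ioi 0) := by
  intro x hx
  have hx' : (0 : ℝ) < x := hx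
  have h := (hw.absolutelyContinuousOnInterval_hardyP (a := x / 2) (b := 2 * x)
    (by positivity) (by positivity)).continuousOn
  refine (h.continuousAt ?_).continuousWithinAt
  rw [uIcc_of_le (by linarith)]
  exact Icc_mem_nhds (by linarith) (by linarith)

theorem MemW.aestronglyMeasurable (hw : MemW w) :
    AEStronglyMeasurable w (volume.restrict (Ioi (0 : ℝ))) := by
  have : (Ioi (0 : ℝ)) = ⋃ n : ℕ, Ioc 0 ((n : ℝ) + 1) := by
    ext x
    simp only [mem_Ioi, mem_iUnion, mem_Ioc]
    refine ⟨fun hx => ?_, fun ⟨n, hn⟩ => hn.1⟩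
    obtain ⟨n, hn⟩ := exists_nat_ge x
    exact ⟨n, hx, by linarith⟩
  rw [this, aestronglyMeasurable_iUnion_iff]
  exact fun n => (hw.1 _ (by positivity)).aestronglyMeasurable

theorem MemW.ae_norm_sub_le (hw : MemW w) :
    ∀ᵐ t ∂(volume.restrict (Ioi (0 : ℝ))), ‖hardyP w t - w t‖ ≤ (normW w).toReal := by
  have h := ae_le_eLpNormEssSup (f := fun t => hardyP w t - w t)
    (μ := volume.restrict (Ioi (0 : ℝ)))
  filter_upwards [h] with t ht
  rw [← toReal_enorm]
  refine ENNReal.toReal_mono hw.2.2.ne ?_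
  rw [normW, eLpNorm_exponent_top]
  exact ht

theorem MemW.ae_interval_norm_sub_le (hw : MemW w) {a b : ℝ} (ha : 0 < a) (hb : 0 < b) :
    ∀ᵐ t, t ∈ uIcc a b → ‖hardyP w t - w t‖ ≤ (normW w).toReal := by
  have := (ae_restrict_iff' measurableSet_Ioi).1 hw.ae_norm_sub_le
  filter_upwards [this] with t ht hx
  exact ht (pos_of_mem_uIcc ha hb hx)

theorem intervalIntegrable_inv_of_pos {a b : ℝ} (ha : 0 < a) (hb : 0 < b) :
    IntervalIntegrable (fun t : ℝ => t⁻¹) volume a b :=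
  (continuousOn_id.inv₀ fun _ hx => (pos_of_mem_uIcc ha hb hx).ne').intervalIntegrable

theorem MemW.intervalIntegrable_deriv_pow (hw : MemW w) {a b : ℝ} (ha : 0 < a) (hb : 0 < b)
    (j : ℕ) : IntervalIntegrable
      (fun t => t⁻¹ • ((hardyP w t ^ j / (j.factorial : 𝕜)) * (w t - hardyP w t))) volume a b := by
  have hc : ContinuousOn (hardyP w) (uIcc a b) :=
    hw.continuousOn_hardyP.mono fun x hx => pos_of_mem_uIcc ha hb hx
  have h1 : IntervalIntegrable (fun t => w t - hardyP w t) volume a b :=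
    (hw.intervalIntegrable ha.le hb.le).sub hc.intervalIntegrable
  have h2 : IntervalIntegrable
      (fun t => (hardyP w t ^ j / (j.factorial : 𝕜)) * (w t - hardyP w t)) volume a b :=
    h1.continuousOn_mul ((hc.pow j).div_const _)
  exact h2.continuousOn_smul
    (continuousOn_id.inv₀ fun _ hx => (pos_of_mem_uIcc ha hb hx).ne')

/-- The fundamental theorem of calculus for the normalized powers of `Pw`, whose derivative is
`t⁻¹ (w - Pw)`. -/
theorem MemW.integral_deriv_pow (hw : MemW w) {a b : ℝ} (ha : 0 < a) (hb : 0 < b) (j : ℕ) :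
    ∫ t in a..b, t⁻¹ • ((hardyP w t ^ j / (j.factorial : 𝕜)) * (w t - hardyP w t)) =
      hardyP w b ^ (j + 1) / ((j + 1).factorial : 𝕜) -
        hardyP w a ^ (j + 1) / ((j + 1).factorial : 𝕜) := by
  have hac : AbsolutelyContinuousOnInterval
      (fun t => hardyP w t ^ (j + 1) / ((j + 1).factorial : 𝕜)) a b := by
    simpa [div_eq_inv_mul] using
      ((hw.absolutelyContinuousOnInterval_hardyP ha hb).pow_rclike (j + 1)).const_smul
        (((j + 1).factorial : 𝕜)⁻¹)
  refine hac.integral_eq_sub_of_ae_hasDerivAt (hw.intervalIntegrable_deriv_pow ha hb j) ?_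
  filter_upwards [hw.ae_hasDerivAt_hardyP ha hb] with x hx hmem
  have h := ((hx hmem).pow (j + 1)).div_const ((j + 1).factorial : 𝕜)
  refine h.congr_deriv ?_
  have hj : ((j.factorial : ℕ) : 𝕜) ≠ 0 := by exact_mod_cast j.factorial_ne_zero
  have hj' : (j : 𝕜) + 1 ≠ 0 := by exact_mod_cast j.succ_ne_zero
  simp only [Nat.factorial_succ, Nat.cast_mul, Nat.cast_add, Nat.cast_one, Nat.add_sub_cancel,
    RCLike.real_smul_eq_coe_mul]
  field_simp

/-- The derivative of `Pw` is at most `‖w‖_W / t` in norm; integrate it from 1 to `t`. -/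
theorem MemW.norm_hardyP_sub_le (hw : MemW w) {t : ℝ} (ht : 0 < t) :
    ‖hardyP w t - hardyP w 1‖ ≤ (normW w).toReal * |Real.log t| := by
  have h := hw.integral_deriv_pow one_pos ht 0
  simp only [pow_zero, Nat.factorial_zero, Nat.cast_one, div_one, one_mul, zero_add, pow_one,
    Nat.factorial_one] at h
  rw [← h]
  have h2 := intervalIntegral.norm_integral_le_abs_of_norm_le (μ := volume) (a := 1) (b := t)
    (f := fun t => t⁻¹ • (w t - hardyP w t)) (g := fun t => (normW w).toReal * t⁻¹) (by
      rw [ae_restrict_iff' measurableSet_uIoc]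
      filter_upwards [hw.ae_interval_norm_sub_le one_pos ht] with x hx hmem
      have hmem' := uIoc_subset_uIcc hmem
      have hx0 := pos_of_mem_uIcc one_pos ht hmem'
      rw [norm_smul, norm_sub_rev, Real.norm_of_nonneg (inv_nonneg.2 hx0.le), mul_comm]
      exact mul_le_mul_of_nonneg_right (hx hmem') (inv_nonneg.2 hx0.le))
    ((intervalIntegrable_inv_of_pos one_pos ht).const_mul _)
  refine h2.trans (le_of_eq ?_)
  rw [intervalIntegral.integral_const_mul, integral_inv_of_pos one_pos ht, div_one, abs_mul,
    abs_of_nonneg ENNReal.toReal_nonneg]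

end Hardy

/-! ### The measure `ds/s`. -/

section Measure

instance : SigmaFinite dsOverS := by
  unfold dsOverS
  infer_instance

theorem dsOverS_absolutelyContinuous : dsOverS ≪ volume.restrict (Ioi (0 : ℝ)) :=
  withDensity_absolutelyContinuous _ _

theorem ae_dsOverS_pos : ∀ᵐ s ∂dsOverS, 0 < s :=
  dsOverS_absolutelyContinuous.ae_le (ae_restrict_mem measurableSet_Ioi)

theorem measurable_ofReal_inv : Measurable fun s : ℝ => ENNReal.ofReal s⁻¹ :=
  measurable_inv.ennreal_ofReal

theorem setLIntegral_dsOverS {S : Set ℝ} (hS : MeasurableSet S) (hpos : S ⊆ Ioi 0)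
    (f : ℝ → ℝ≥0∞) : ∫⁻ s in S, f s ∂dsOverS = ∫⁻ s in S, ENNReal.ofReal s⁻¹ * f s := by
  rw [dsOverS, setLIntegral_withDensity_eq_setLIntegral_mul_non_measurable _ measurable_ofReal_inv
    _ hS (ae_of_all _ fun _ => ENNReal.ofReal_lt_top), Measure.restrict_restrict hS,
    inter_eq_left.2 hpos]
  rfl

theorem setIntegral_dsOverS {E : Type*} [NormedAddCommGroup E] [NormedSpace ℝ E] {S : Set ℝ}
    (hS : MeasurableSet S) (hpos : S ⊆ Ioi 0) (f : ℝ → E) :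
    ∫ s in S, f s ∂dsOverS = ∫ s in S, s⁻¹ • f s := by
  rw [dsOverS, restrict_withDensity hS, Measure.restrict_restrict hS, inter_eq_left.2 hpos,
    integral_withDensity_eq_integral_toReal_smul measurable_ofReal_inv
    (ae_of_all _ fun _ => ENNReal.ofReal_lt_top)]
  refine setIntegral_congr_fun hS fun s hs => ?_
  have hs0 : (0 : ℝ) < s := hpos hs
  simp only [ENNReal.toReal_ofReal (inv_nonneg.2 hs0.le)]

end Measure

/-! ### Schur's test. -/

section Schur

variable {α β : Type*} [MeasurableSpace α] [MeasurableSpace β] {μ : Measure α} {ν : Measure β}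

/-- Schur's test for a nonnegative kernel whose marginals are both bounded by `A`. -/
theorem eLpNorm_lintegral_mul_le [SFinite μ] [SFinite ν] {k : α → β → ℝ≥0∞}
    (hk : Measurable (Function.uncurry k)) {A : ℝ≥0∞} (hA : A ≠ ∞)
    (h₁ : ∀ᵐ x ∂μ, ∫⁻ y, k x y ∂ν ≤ A) (h₂ : ∀ᵐ y ∂ν, ∫⁻ x, k x y ∂μ ≤ A)
    {q : ℝ≥0∞} (hq : 1 ≤ q) {F : β → ℝ≥0∞} (hF : AEMeasurable F ν) :
    eLpNorm (fun x => ∫⁻ y, k x y * F y ∂ν) q μ ≤ A * eLpNorm F q ν := by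
  have hkx : ∀ x, Measurable (k x) := fun x => hk.comp measurable_prodMk_left
  have hky : ∀ y, Measurable fun x => k x y := fun y => hk.comp measurable_prodMk_right
  rcases eq_or_ne q ∞ with rfl | hqtop
  · simp only [eLpNorm_exponent_top]
    refine essSup_le_of_ae_le _ ?_
    filter_upwards [h₁] with x hx
    calc ∫⁻ y, k x y * F y ∂ν ≤ ∫⁻ y, k x y * eLpNormEssSup F ν ∂ν := by
          refine lintegral_mono_ae ?_
          filter_upwards [ae_le_eLpNormEssSup (f := F) (μ := ν)] with y hy
          exact mul_le_mul_right hy _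
      _ = (∫⁻ y, k x y ∂ν) * eLpNormEssSup F ν := lintegral_mul_const _ (hkx x)
      _ ≤ A * eLpNormEssSup F ν := mul_le_mul_left hx _
  have hq0 : q ≠ 0 := (zero_lt_one.trans_le hq).ne'
  set p := q.toReal with hp
  have hp1 : 1 ≤ p := by
    rw [hp, ← ENNReal.toReal_one]
    exact ENNReal.toReal_mono hqtop hq
  have hp0 : 0 < p := zero_lt_one.trans_le hp1
  have hinv : 1 / p ≤ 1 := (div_le_one hp0).2 hp1
  rw [eLpNorm_eq_lintegral_rpow_enorm_toReal hq0 hqtop,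
    eLpNorm_eq_lintegral_rpow_enorm_toReal hq0 hqtop]
  simp only [enorm_eq_self, ← hp]
  have key : ∀ᵐ x ∂μ, (∫⁻ y, k x y * F y ∂ν) ^ p ≤ A ^ (p - 1) * ∫⁻ y, k x y * F y ^ p ∂ν := by
    filter_upwards [h₁] with x hx
    -- Hölder applied to `k F = k^{1-1/p} (k F^p)^{1/p}`; the form with exponents `1 - 1/p` and
    -- `1/p` includes `p = 1`.
    have hol := ENNReal.lintegral_mul_norm_pow_le (μ := ν) (f := k x)
      (g := fun y => k x y * F y ^ p) (hkx x).aemeasurable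
      ((hkx x).aemeasurable.mul (hF.pow_const p)) (p := 1 - 1 / p) (q := 1 / p)
      (by linarith) (by positivity) (by ring)
    have e : ∀ y, k x y ^ (1 - 1 / p) * (k x y * F y ^ p) ^ (1 / p) = k x y * F y := fun y => by
      rw [ENNReal.mul_rpow_of_nonneg _ _ (by positivity : 0 ≤ 1 / p), ← mul_assoc,
        ← ENNReal.rpow_add_of_nonneg _ _ (by linarith) (by positivity), ← ENNReal.rpow_mul,
        mul_one_div_cancel hp0.ne']
      simp
    simp only [e] at hol
    calc (∫⁻ y, k x y * F y ∂ν) ^ p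
        ≤ ((∫⁻ y, k x y ∂ν) ^ (1 - 1 / p) * (∫⁻ y, k x y * F y ^ p ∂ν) ^ (1 / p)) ^ p :=
          ENNReal.rpow_le_rpow hol hp0.le
      _ = (∫⁻ y, k x y ∂ν) ^ (p - 1) * ∫⁻ y, k x y * F y ^ p ∂ν := by
          rw [ENNReal.mul_rpow_of_nonneg _ _ hp0.le, ← ENNReal.rpow_mul, ← ENNReal.rpow_mul,
            one_div_mul_cancel hp0.ne', ENNReal.rpow_one]
          congr 2
          field_simp
      _ ≤ A ^ (p - 1) * ∫⁻ y, k x y * F y ^ p ∂ν :=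
          mul_le_mul_left (ENNReal.rpow_le_rpow hx (by linarith)) _
  have total : ∫⁻ x, (∫⁻ y, k x y * F y ∂ν) ^ p ∂μ ≤ A ^ p * ∫⁻ y, F y ^ p ∂ν := by
    calc ∫⁻ x, (∫⁻ y, k x y * F y ∂ν) ^ p ∂μ
        ≤ ∫⁻ x, A ^ (p - 1) * ∫⁻ y, k x y * F y ^ p ∂ν ∂μ := lintegral_mono_ae key
      _ = A ^ (p - 1) * ∫⁻ x, ∫⁻ y, k x y * F y ^ p ∂ν ∂μ :=
          lintegral_const_mul' _ _ (ENNReal.rpow_ne_top_of_nonneg (by linarith) hA)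
      _ = A ^ (p - 1) * ∫⁻ y, ∫⁻ x, k x y * F y ^ p ∂μ ∂ν := by
          congr 1
          refine lintegral_lintegral_swap ?_
          exact hk.aemeasurable.mul (hF.comp_snd.pow_const p)
      _ = A ^ (p - 1) * ∫⁻ y, (∫⁻ x, k x y ∂μ) * F y ^ p ∂ν := by
          congr 1
          exact lintegral_congr fun y => lintegral_mul_const _ (hky y)
      _ ≤ A ^ (p - 1) * ∫⁻ y, A * F y ^ p ∂ν := by
          refine mul_le_mul_right (lintegral_mono_ae ?_) _
          filter_upwards [h₂] with y hy
          exact mul_le_mul_left hy _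
      _ = A ^ p * ∫⁻ y, F y ^ p ∂ν := by
          rw [lintegral_const_mul' _ _ hA, ← mul_assoc]
          congr 1
          nth_rewrite 2 [← ENNReal.rpow_one A]
          rw [← ENNReal.rpow_add_of_nonneg _ _ (by linarith) zero_le_one]
          congr 1
          ring
  calc (∫⁻ x, (∫⁻ y, k x y * F y ∂ν) ^ p ∂μ) ^ (1 / p)
      ≤ (A ^ p * ∫⁻ y, F y ^ p ∂ν) ^ (1 / p) := ENNReal.rpow_le_rpow total (by positivity)
    _ = A * (∫⁻ y, F y ^ p ∂ν) ^ (1 / p) := by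
        rw [ENNReal.mul_rpow_of_nonneg _ _ (by positivity), ← ENNReal.rpow_mul,
          mul_one_div_cancel hp0.ne', ENNReal.rpow_one]

end Schur

/-! ### The Calderón operator, Hardy's inequalities and logarithmic weights. -/

section Calderon

/-- The kernel `min {(s/t)^θ, (t/s)^{1-θ}}` of the Calderón operator acting on
`L^q(s^{-θ}, ds/s)`. -/
def calderonKernel (θ t s : ℝ) : ℝ≥0∞ := ENNReal.ofReal (min ((s / t) ^ θ) ((t / s) ^ (1 - θ)))

/-- The norm bound `1/θ + 1/(1-θ)` of the Calderón operator. -/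
def calderonConst (θ : ℝ) : ℝ≥0∞ := ENNReal.ofReal (1 / θ + 1 / (1 - θ))

theorem calderonConst_ne_top (θ : ℝ) : calderonConst θ ≠ ∞ := ENNReal.ofReal_ne_top

theorem measurable_calderonKernel (θ : ℝ) :
    Measurable (Function.uncurry (calderonKernel θ)) := by
  unfold calderonKernel Function.uncurry
  fun_prop

/-- By this symmetry the second marginal bound in Schur's test follows from the first, with `1 - θ`
for `θ`. -/
theorem calderonKernel_swap (θ t s : ℝ) : calderonKernel θ t s = calderonKernel (1 - θ) s t := by
  simp [calderonKernel, min_comm]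

theorem setIntegral_Ioc_rpow {θ t : ℝ} (hθ : 0 < θ) (ht : 0 < t) :
    ∫ s in Ioc 0 t, s⁻¹ * (s / t) ^ θ = 1 / θ := by
  have h : ∫ s in Ioc 0 t, s⁻¹ * (s / t) ^ θ = ∫ s in Ioc 0 t, t ^ (-θ) * s ^ (θ - 1) := by
    refine setIntegral_congr_fun measurableSet_Ioc fun s hs => ?_
    rw [Real.div_rpow hs.1.le ht.le, Real.rpow_sub_one hs.1.ne', Real.rpow_neg ht.le]
    field_simp
  rw [h, integral_const_mul, ← intervalIntegral.integral_of_le ht.le,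
    integral_rpow (Or.inl (by linarith)), Real.rpow_neg ht.le]
  have : t ^ θ ≠ 0 := (Real.rpow_pos_of_pos ht θ).ne'
  simp [Real.zero_rpow hθ.ne']
  field_simp

/-- The integral of a non-integrable function is 0 by convention, whereas this one has the value `1
/ θ ≠ 0`. -/
theorem integrableOn_Ioc_rpow {θ t : ℝ} (hθ : 0 < θ) (ht : 0 < t) :
    IntegrableOn (fun s => s⁻¹ * (s / t) ^ θ) (Ioc 0 t) := by
  by_contra h
  have := setIntegral_Ioc_rpow hθ ht
  rw [integral_undef h] at this
  exact (by positivity : (1 / θ) ≠ 0) this.symm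

theorem setIntegral_Ioi_rpow {θ t : ℝ} (hθ : 0 < θ) (ht : 0 < t) :
    ∫ s in Ioi t, s⁻¹ * (t / s) ^ θ = 1 / θ := by
  have h : ∫ s in Ioi t, s⁻¹ * (t / s) ^ θ = ∫ s in Ioi t, t ^ θ * s ^ (-θ - 1) := by
    refine setIntegral_congr_fun measurableSet_Ioi fun s hs => ?_
    have hs0 : 0 < s := ht.trans hs
    rw [Real.div_rpow ht.le hs0.le, Real.rpow_sub_one hs0.ne', Real.rpow_neg hs0.le]
    field_simp
  rw [h, integral_const_mul, integral_Ioi_rpow_of_lt (by linarith) ht]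
  have : t ^ θ ≠ 0 := (Real.rpow_pos_of_pos ht θ).ne'
  simp [Real.rpow_neg ht.le]
  field_simp

theorem integrableOn_Ioi_rpow_div {θ t : ℝ} (hθ : 0 < θ) (ht : 0 < t) :
    IntegrableOn (fun s => s⁻¹ * (t / s) ^ θ) (Ioi t) := by
  by_contra h
  have := setIntegral_Ioi_rpow hθ ht
  rw [integral_undef h] at this
  exact (by positivity : (1 / θ) ≠ 0) this.symm

/-- Cut at `s = t`: the first entry of the minimum contributes `1/θ` on `(0, t]`, the second
`1/(1-θ)` beyond. -/
theorem lintegral_calderonKernel_le {θ : ℝ} (hθ₀ : 0 < θ) (hθ₁ : θ < 1) {t : ℝ} (ht : 0 < t) :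
    ∫⁻ s, calderonKernel θ t s ∂dsOverS ≤ calderonConst θ := by
  have hθ' : 0 < 1 - θ := by linarith
  have hnull : ∫⁻ s in (Ioi (0 : ℝ))ᶜ, calderonKernel θ t s ∂dsOverS = 0 := by
    refine setLIntegral_measure_zero _ _ ?_
    simpa [ae_iff, compl_def] using ae_dsOverS_pos
  rw [← lintegral_add_compl _ (measurableSet_Ioi (a := (0 : ℝ))), hnull, add_zero,
    ← Ioc_union_Ioi_eq_Ioi ht.le,
    lintegral_union measurableSet_Ioi (Ioc_disjoint_Ioi le_rfl),
    setLIntegral_dsOverS measurableSet_Ioc (fun s hs => hs.1),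
    setLIntegral_dsOverS measurableSet_Ioi (fun s hs => ht.trans hs), calderonConst,
    ENNReal.ofReal_add (by positivity) (by positivity)]
  refine add_le_add ?_ ?_
  · rw [← setIntegral_Ioc_rpow hθ₀ ht, ofReal_integral_eq_lintegral_ofReal
      (integrableOn_Ioc_rpow hθ₀ ht) ((ae_restrict_iff' measurableSet_Ioc).2
        (ae_of_all _ fun s hs => mul_nonneg (inv_nonneg.2 hs.1.le) (Real.rpow_nonneg (div_nonneg hs.1.le ht.le) _)))]
    refine setLIntegral_mono' measurableSet_Ioc fun s hs => ?_
    rw [ENNReal.ofReal_mul (inv_nonneg.2 hs.1.le)]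
    exact mul_le_mul_right (ENNReal.ofReal_le_ofReal (min_le_left _ _)) _
  · have h0 : ∀ s ∈ Ioi t, 0 < s := fun s hs => ht.trans hs
    rw [← setIntegral_Ioi_rpow hθ' ht, ofReal_integral_eq_lintegral_ofReal
      (integrableOn_Ioi_rpow_div hθ' ht) ((ae_restrict_iff' measurableSet_Ioi).2
        (ae_of_all _ fun s hs => mul_nonneg (inv_nonneg.2 (h0 s hs).le)
          (Real.rpow_nonneg (div_nonneg ht.le (h0 s hs).le) _)))]
    refine setLIntegral_mono' measurableSet_Ioi fun s hs => ?_
    rw [ENNReal.ofReal_mul (inv_nonneg.2 (h0 s hs).le)]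
    exact mul_le_mul_right (ENNReal.ofReal_le_ofReal (min_le_right _ _)) _

theorem lintegral_calderonKernel_le' {θ : ℝ} (hθ₀ : 0 < θ) (hθ₁ : θ < 1) {s : ℝ} (hs : 0 < s) :
    ∫⁻ t, calderonKernel θ t s ∂dsOverS ≤ calderonConst θ := by
  simp_rw [calderonKernel_swap θ]
  refine (lintegral_calderonKernel_le (by linarith) (by linarith) hs).trans (le_of_eq ?_)
  rw [calderonConst, calderonConst, sub_sub_cancel, add_comm]

/-- The Calderón operator `F ↦ ∫ min {1, t/s} F(s) ds/s`. -/
def calderon (F : ℝ → ℝ≥0∞) (t : ℝ) : ℝ≥0∞ :=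
  ∫⁻ s, ENNReal.ofReal (min 1 (t / s)) * F s ∂dsOverS

/-- Conjugating the kernel `min {1, t/s}` by the weight `s^{-θ}` reduces the weighted estimate to an
unweighted one, to which Schur's test applies. -/
theorem rpow_mul_min_eq {θ t s : ℝ} (ht : 0 < t) (hs : 0 < s) :
    t ^ (-θ) * min 1 (t / s) = min ((s / t) ^ θ) ((t / s) ^ (1 - θ)) * s ^ (-θ) := by
  have hsθ : 0 < s ^ θ := Real.rpow_pos_of_pos hs θ
  have htθ : 0 < t ^ θ := Real.rpow_pos_of_pos ht θ
  rw [mul_min_of_nonneg _ _ (Real.rpow_nonneg ht.le _),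
    min_mul_of_nonneg _ _ (Real.rpow_nonneg hs.le _)]
  congr 1
  · rw [Real.div_rpow hs.le ht.le, Real.rpow_neg ht.le, Real.rpow_neg hs.le]
    field_simp
  · rw [Real.rpow_sub (div_pos ht hs), Real.rpow_one, Real.div_rpow ht.le hs.le,
      Real.rpow_neg ht.le, Real.rpow_neg hs.le]
    field_simp

theorem ofReal_rpow_mul_calderon (θ : ℝ) (F : ℝ → ℝ≥0∞) {t : ℝ} (ht : 0 < t) :
    ENNReal.ofReal (t ^ (-θ)) * calderon F t =
      ∫⁻ s, calderonKernel θ t s * (ENNReal.ofReal (s ^ (-θ)) * F s) ∂dsOverS := by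
  rw [calderon, ← lintegral_const_mul' _ _ ENNReal.ofReal_ne_top]
  refine lintegral_congr_ae ?_
  filter_upwards [ae_dsOverS_pos] with s hs
  rw [← mul_assoc, ← mul_assoc, calderonKernel, ← ENNReal.ofReal_mul (Real.rpow_nonneg ht.le _),
    ← ENNReal.ofReal_mul (le_min (Real.rpow_nonneg (div_nonneg hs.le ht.le) _)
      (Real.rpow_nonneg (div_nonneg ht.le hs.le) _)), rpow_mul_min_eq ht hs]

/-- The Hardy inequalities: the Calderón operator is bounded on `L^q(s^{-θ}, ds/s)`. -/
theorem eLpNorm_calderon_le {θ : ℝ} (hθ₀ : 0 < θ) (hθ₁ : θ < 1) {q : ℝ≥0∞} (hq : 1 ≤ q)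
    {F : ℝ → ℝ≥0∞} (hF : AEMeasurable F dsOverS) :
    eLpNorm (fun t => ENNReal.ofReal (t ^ (-θ)) * calderon F t) q dsOverS ≤
      calderonConst θ * eLpNorm (fun s => ENNReal.ofReal (s ^ (-θ)) * F s) q dsOverS := by
  have e : eLpNorm (fun t => ENNReal.ofReal (t ^ (-θ)) * calderon F t) q dsOverS =
      eLpNorm (fun t => ∫⁻ s, calderonKernel θ t s * (ENNReal.ofReal (s ^ (-θ)) * F s) ∂dsOverS) q
        dsOverS := by
    refine eLpNorm_congr_ae ?_
    filter_upwards [ae_dsOverS_pos] with t ht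
    exact ofReal_rpow_mul_calderon θ F ht
  rw [e]
  refine eLpNorm_lintegral_mul_le (measurable_calderonKernel θ) (calderonConst_ne_top θ) ?_ ?_ hq ?_
  · filter_upwards [ae_dsOverS_pos] with t ht using lintegral_calderonKernel_le hθ₀ hθ₁ ht
  · filter_upwards [ae_dsOverS_pos] with s hs using lintegral_calderonKernel_le' hθ₀ hθ₁ hs
  · have : Measurable fun s : ℝ => ENNReal.ofReal (s ^ (-θ)) := by fun_prop
    exact this.aemeasurable.mul hF

/-- For finite `q`, the integrand is at most `ρ` where `G ≤ 1` and at most `B G^q` where `G ≥ 1`;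
this replaces Hölder's inequality. -/
theorem lintegral_mul_lt_top_of_eLpNorm_lt_top {α : Type*} [MeasurableSpace α] {μ : Measure α}
    {ρ G : α → ℝ≥0∞} (hρ : AEMeasurable ρ μ) {B : ℝ≥0∞} (hB : B ≠ ∞) (hle : ∀ᵐ x ∂μ, ρ x ≤ B)
    (hint : ∫⁻ x, ρ x ∂μ < ∞) {q : ℝ≥0∞} (hq : 1 ≤ q) (hG : eLpNorm G q μ < ∞) :
    ∫⁻ x, ρ x * G x ∂μ < ∞ := by
  rcases eq_or_ne q ∞ with rfl | hqtop
  · rw [eLpNorm_exponent_top] at hG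
    calc ∫⁻ x, ρ x * G x ∂μ ≤ ∫⁻ x, ρ x * eLpNormEssSup G μ ∂μ := by
          refine lintegral_mono_ae ?_
          filter_upwards [ae_le_eLpNormEssSup (f := G) (μ := μ)] with x hx
          exact mul_le_mul_right hx _
      _ = (∫⁻ x, ρ x ∂μ) * eLpNormEssSup G μ := lintegral_mul_const' _ _ hG.ne
      _ < ∞ := ENNReal.mul_lt_top hint hG
  have hq0 : q ≠ 0 := (zero_lt_one.trans_le hq).ne'
  have hp1 : 1 ≤ q.toReal := by
    rw [← ENNReal.toReal_one]
    exact ENNReal.toReal_mono hqtop hq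
  rw [eLpNorm_lt_top_iff_lintegral_rpow_enorm_lt_top hq0 hqtop] at hG
  simp only [enorm_eq_self] at hG
  calc ∫⁻ x, ρ x * G x ∂μ ≤ ∫⁻ x, (ρ x + B * G x ^ q.toReal) ∂μ := by
        refine lintegral_mono_ae ?_
        filter_upwards [hle] with x hx
        rcases le_total (G x) 1 with h | h
        · calc ρ x * G x ≤ ρ x * 1 := mul_le_mul_right h _
            _ ≤ _ := by rw [mul_one]; exact le_self_add
        · calc ρ x * G x ≤ B * G x ^ q.toReal := by
                refine mul_le_mul' hx ?_
                calc G x = G x ^ (1 : ℝ) := (ENNReal.rpow_one _).symm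
                  _ ≤ _ := ENNReal.rpow_le_rpow_of_exponent_le h hp1
            _ ≤ _ := le_add_self
    _ = ∫⁻ x, ρ x ∂μ + B * ∫⁻ x, G x ^ q.toReal ∂μ := by
        rw [lintegral_add_left' hρ, lintegral_const_mul' _ _ hB]
    _ < ∞ := ENNReal.add_lt_top.2 ⟨hint, ENNReal.mul_lt_top hB.lt_top hG⟩

theorem exp_abs_log_le {ε s : ℝ} (hs : 0 < s) :
    Real.exp (ε * |Real.log s|) ≤ s ^ ε + s ^ (-ε) := by
  rw [Real.rpow_def_of_pos hs, Real.rpow_def_of_pos hs]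
  rcases abs_cases (Real.log s) with ⟨h, _⟩ | ⟨h, _⟩ <;> rw [h]
  · rw [mul_comm ε]
    linarith [Real.exp_pos (Real.log s * -ε)]
  · rw [show ε * -Real.log s = Real.log s * -ε by ring]
    linarith [Real.exp_pos (Real.log s * ε)]

/-- Take `x = ε (1 + |log s|)` in `x^k / k! ≤ e^x`. -/
theorem one_add_abs_log_pow_le {ε : ℝ} (hε : 0 < ε) (k : ℕ) :
    ∃ D : ℝ, 0 ≤ D ∧ ∀ s : ℝ, 0 < s → (1 + |Real.log s|) ^ k ≤ D * (s ^ ε + s ^ (-ε)) := by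
  refine ⟨k.factorial * (ε ^ k)⁻¹ * Real.exp ε, by positivity, fun s hs => ?_⟩
  have h := Real.pow_div_factorial_le_exp (ε * (1 + |Real.log s|)) (by positivity) k
  have hf : (0 : ℝ) < k.factorial := by exact_mod_cast k.factorial_pos
  rw [mul_pow, mul_add, mul_one, Real.exp_add, div_le_iff₀ hf] at h
  have h2 := exp_abs_log_le (ε := ε) hs
  have h3 : Real.exp ε * Real.exp (ε * |Real.log s|) ≤ Real.exp ε * (s ^ ε + s ^ (-ε)) :=
    mul_le_mul_of_nonneg_left h2 (Real.exp_pos _).le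
  calc (1 + |Real.log s|) ^ k = (ε ^ k)⁻¹ * (ε ^ k * (1 + |Real.log s|) ^ k) := by
        field_simp
    _ ≤ (ε ^ k)⁻¹ * (Real.exp ε * (s ^ ε + s ^ (-ε)) * k.factorial) := by
        refine mul_le_mul_of_nonneg_left (h.trans ?_) (by positivity)
        exact mul_le_mul_of_nonneg_right h3 hf.le
    _ = _ := by ring

/-- A factor `s^ε` merely moves `θ` to `θ + ε`, so small powers of `s` are harmless. -/
theorem rpow_mul_calderonKernel_one {θ ε s : ℝ} (hs : 0 < s) :
    s ^ ε * min ((s / 1) ^ θ) ((1 / s) ^ (1 - θ)) =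
      min ((s / 1) ^ (θ + ε)) ((1 / s) ^ (1 - (θ + ε))) := by
  rw [mul_min_of_nonneg _ _ (Real.rpow_nonneg hs.le _)]
  have h : ∀ x : ℝ, (1 / s) ^ x = s ^ (-x) := fun x => by
    rw [one_div, Real.inv_rpow hs.le, Real.rpow_neg hs.le]
  rw [div_one, h, h, ← Real.rpow_add hs, ← Real.rpow_add hs]
  congr 2 <;> ring

theorem calderonKernel_le_one {θ t s : ℝ} (hθ₀ : 0 < θ) (hθ₁ : θ < 1) (ht : 0 < t)
    (hs : 0 < s) : calderonKernel θ t s ≤ 1 := by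
  refine ENNReal.ofReal_le_one.2 ?_
  rcases le_total s t with h | h
  · exact (min_le_left _ _).trans (Real.rpow_le_one (by positivity) ((div_le_one ht).2 h) hθ₀.le)
  · exact (min_le_right _ _).trans (Real.rpow_le_one (by positivity)
      ((div_le_one hs).2 h) (by linarith))

/-- The norm inequality would give finiteness only for almost every `t`; the kernel, bounded and
integrable in `s`, gives it for each `t`. -/
theorem calderon_lt_top {θ : ℝ} (hθ₀ : 0 < θ) (hθ₁ : θ < 1) {q : ℝ≥0∞} (hq : 1 ≤ q)
    {F : ℝ → ℝ≥0∞}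
    (hfin : eLpNorm (fun s => ENNReal.ofReal (s ^ (-θ)) * F s) q dsOverS < ∞) {t : ℝ}
    (ht : 0 < t) : calderon F t < ∞ := by
  have h : ENNReal.ofReal (t ^ (-θ)) * calderon F t < ∞ := by
    rw [ofReal_rpow_mul_calderon θ F ht]
    refine lintegral_mul_lt_top_of_eLpNorm_lt_top
      ((measurable_calderonKernel θ).comp measurable_prodMk_left).aemeasurable ENNReal.one_ne_top
      ?_ ((lintegral_calderonKernel_le hθ₀ hθ₁ ht).trans_lt (calderonConst_ne_top θ).lt_top) hq hfin
    filter_upwards [ae_dsOverS_pos] with s hs using calderonKernel_le_one hθ₀ hθ₁ ht hs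
  have hpos : 0 < ENNReal.ofReal (t ^ (-θ)) := ENNReal.ofReal_pos.2 (Real.rpow_pos_of_pos ht _)
  exact ENNReal.lt_top_of_mul_ne_top_right h.ne hpos.ne.symm

/-- A function in `L^q(s^{-θ}, ds/s)` is integrable against `min {1, 1/s}` times any power of
`1 + |log s|`. -/
theorem lintegral_log_pow_mul_lt_top {θ : ℝ} (hθ₀ : 0 < θ) (hθ₁ : θ < 1) {q : ℝ≥0∞} (hq : 1 ≤ q)
    {F : ℝ → ℝ≥0∞}
    (hfin : eLpNorm (fun s => ENNReal.ofReal (s ^ (-θ)) * F s) q dsOverS < ∞) (k : ℕ) :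
    ∫⁻ s, ENNReal.ofReal ((1 + |Real.log s|) ^ k * min 1 (1 / s)) * F s ∂dsOverS < ∞ := by
  -- Both `θ + ε` and `θ - ε` must stay inside `(0, 1)`.
  obtain ⟨ε, hε, h1, h2⟩ : ∃ ε : ℝ, 0 < ε ∧ ε < θ ∧ θ + ε < 1 := by
    refine ⟨min θ (1 - θ) / 2, ?_, ?_, ?_⟩
    · have : 0 < min θ (1 - θ) := lt_min hθ₀ (by linarith)
      linarith
    · have := min_le_left θ (1 - θ)
      linarith
    · have := min_le_right θ (1 - θ)
      linarith
  obtain ⟨D, hD, hlog⟩ := one_add_abs_log_pow_le hε k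
  let ρ : ℝ → ℝ≥0∞ := fun s => ENNReal.ofReal D *
    (calderonKernel (θ + ε) 1 s + calderonKernel (θ + -ε) 1 s)
  have hmeas : ∀ θ' : ℝ, Measurable fun s => calderonKernel θ' 1 s := fun θ' =>
    (measurable_calderonKernel θ').comp measurable_prodMk_left
  have hρ : ∫⁻ s, ρ s * (ENNReal.ofReal (s ^ (-θ)) * F s) ∂dsOverS < ∞ := by
    refine lintegral_mul_lt_top_of_eLpNorm_lt_top (B := ENNReal.ofReal D * (1 + 1)) ?_ ?_ ?_ ?_ hq
      hfin
    · exact (((hmeas _).add (hmeas _)).const_mul _).aemeasurable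
    · exact ENNReal.mul_ne_top ENNReal.ofReal_ne_top (by norm_num)
    · filter_upwards [ae_dsOverS_pos] with s hs
      exact mul_le_mul_right (add_le_add
        (calderonKernel_le_one (by linarith) (by linarith) one_pos hs)
        (calderonKernel_le_one (by linarith) (by linarith) one_pos hs)) _
    · simp only [ρ]
      rw [lintegral_const_mul' _ _ ENNReal.ofReal_ne_top, lintegral_add_left (hmeas _)]
      refine ENNReal.mul_lt_top ENNReal.ofReal_lt_top (ENNReal.add_lt_top.2 ⟨?_, ?_⟩)
      · exact (lintegral_calderonKernel_le (by linarith) (by linarith) one_pos).trans_lt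
          (calderonConst_ne_top _).lt_top
      · exact (lintegral_calderonKernel_le (by linarith) (by linarith) one_pos).trans_lt
          (calderonConst_ne_top _).lt_top
  refine lt_of_le_of_lt (lintegral_mono_ae ?_) hρ
  filter_upwards [ae_dsOverS_pos] with s hs
  rw [← mul_assoc]
  refine mul_le_mul_left ?_ _
  have hpos : ∀ θ' : ℝ, 0 ≤ min ((s / 1) ^ θ') ((1 / s) ^ (1 - θ')) := fun θ' =>
    le_min (by positivity) (by positivity)
  simp only [ρ, calderonKernel]
  rw [← ENNReal.ofReal_add (hpos _) (hpos _), ← ENNReal.ofReal_mul hD,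
    ← ENNReal.ofReal_mul (mul_nonneg hD (add_nonneg (hpos _) (hpos _)))]
  refine ENNReal.ofReal_le_ofReal ?_
  rw [← rpow_mul_calderonKernel_one hs, ← rpow_mul_calderonKernel_one hs, ← add_mul, ← mul_assoc,
    mul_assoc (D * _), ← rpow_mul_min_eq one_pos hs, Real.one_rpow, one_mul]
  exact mul_le_mul_of_nonneg_right (hlog s hs) (le_min zero_le_one (by positivity))

end Calderon

/-! ### Integration by parts through Fubini. -/

section Primitive

variable {𝕜 : Type v} [RCLike 𝕜]

/-- Integration by parts for `∫ G(s) b(s) ds/s` when `∫ b(s) ds/s = 0` and `γ(t)` is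
`-t` times the derivative of `G` at `t`. -/
theorem integral_smul_eq_integral_smul_primitive {E : Type*} [NormedAddCommGroup E]
    [NormedSpace ℝ E] [NormedSpace 𝕜 E] [CompleteSpace E] {b : ℝ → E} {G γ : ℝ → 𝕜}
    {F : ℝ → ℝ≥0∞} (hb : Integrable b dsOverS) (hb0 : ∫ s, b s ∂dsOverS = 0)
    (hGb : Integrable (fun s => G s • b s) dsOverS) (hγ : AEStronglyMeasurable γ dsOverS)
    (hG : ∀ x y, 0 < x → x ≤ y → ∫ t in Ioc x y, γ t ∂dsOverS = G x - G y)
    (hle : ∀ᵐ s ∂dsOverS, ‖b s‖ₑ ≤ ENNReal.ofReal (min 1 (1 / s)) * F s)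
    (hfin : ∫⁻ t, ‖γ t‖ₑ * (ENNReal.ofReal (min 1 (1 / t)) * calderon F t) ∂dsOverS < ∞) :
    ∫ s, G s • b s ∂dsOverS = ∫ t, γ t • ∫ s in Iio t, b s ∂dsOverS ∂dsOverS := by
  classical
  -- For all `t`, `s` this is `1_{s<t} - 1_{t>1}`. The subtracted term integrates to zero against
  -- `b`, and it provides decay for large `t`. Integrating `κ γ` in `t` gives `G(s) - G(1)`.
  let κ : ℝ → ℝ → 𝕜 := fun t s => if s < t ∧ t ≤ 1 then 1 else if 1 < t ∧ t ≤ s then -1 else 0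
  let B : ℝ → ℝ → E := fun t s => (κ t s * γ t) • b s
  have hκ : Measurable (Function.uncurry κ) := by
    refine Measurable.ite ?_ measurable_const (Measurable.ite ?_ measurable_const measurable_const)
    · exact (measurableSet_lt measurable_snd measurable_fst).inter
        (measurableSet_le measurable_fst measurable_const)
    · exact (measurableSet_lt measurable_const measurable_fst).inter
        (measurableSet_le measurable_fst measurable_snd)
  have hBm : AEStronglyMeasurable (Function.uncurry B) (dsOverS.prod dsOverS) :=
    (hκ.aestronglyMeasurable.mul hγ.comp_fst).smul hb.aestronglyMeasurable.comp_snd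
  -- This domination puts the double integral under the finite integral of `hfin`.
  have hκle : ∀ t s : ℝ, 0 < t → 0 < s → ‖κ t s‖ₑ * ENNReal.ofReal (min 1 (1 / s)) ≤
      ENNReal.ofReal (min 1 (1 / t)) * ENNReal.ofReal (min 1 (t / s)) := by
    intro t s ht hs
    simp only [κ]
    split_ifs with h1 h2
    · have e1 : min 1 (1 / t) = 1 := min_eq_left ((le_div_iff₀ ht).2 (by linarith [h1.2]))
      have e2 : min 1 (t / s) = 1 := min_eq_left ((le_div_iff₀ hs).2 (by linarith [h1.1]))
      rw [e1, e2]
      simp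
    · have e1 : min 1 (1 / t) = 1 / t := min_eq_right ((div_le_iff₀ ht).2 (by linarith [h2.1]))
      have e2 : min 1 (t / s) = t / s := min_eq_right ((div_le_iff₀ hs).2 (by linarith [h2.2]))
      rw [e1, e2, ← ENNReal.ofReal_mul (by positivity), div_mul_div_cancel₀ ht.ne']
      simp only [enorm_neg, enorm_one, one_mul]
      exact ENNReal.ofReal_le_ofReal (min_le_right _ _)
    · simp
  have hBint : Integrable (Function.uncurry B) (dsOverS.prod dsOverS) := by
    refine ⟨hBm, ?_⟩
    rw [HasFiniteIntegral, lintegral_prod _ hBm.enorm]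
    refine lt_of_le_of_lt (lintegral_mono_ae ?_) hfin
    filter_upwards [ae_dsOverS_pos] with t ht
    rw [calderon, ← lintegral_const_mul' _ _ ENNReal.ofReal_ne_top,
      ← lintegral_const_mul' _ _ enorm_ne_top]
    refine lintegral_mono_ae ?_
    filter_upwards [ae_dsOverS_pos, hle] with s hs hbs
    simp only [Function.uncurry_apply_pair, B, enorm_smul, enorm_mul]
    calc ‖κ t s‖ₑ * ‖γ t‖ₑ * ‖b s‖ₑ
        ≤ ‖κ t s‖ₑ * ‖γ t‖ₑ * (ENNReal.ofReal (min 1 (1 / s)) * F s) := mul_le_mul_right hbs _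
      _ = ‖γ t‖ₑ * ((‖κ t s‖ₑ * ENNReal.ofReal (min 1 (1 / s))) * F s) := by ring
      _ ≤ ‖γ t‖ₑ * ((ENNReal.ofReal (min 1 (1 / t)) * ENNReal.ofReal (min 1 (t / s))) * F s) :=
          mul_le_mul_right (mul_le_mul_left (hκle t s ht hs) _) _
      _ = _ := by ring
  have hinner_s : ∀ t, ∫ s, B t s ∂dsOverS = γ t • ∫ s in Iio t, b s ∂dsOverS := by
    intro t
    rcases le_or_gt t 1 with ht | ht
    · rw [← integral_indicator measurableSet_Iio, ← integral_smul]
      refine integral_congr_ae (ae_of_all _ fun s => ?_)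
      by_cases hs : s < t <;> simp [B, κ, hs, ht, not_lt.2 ht]
    -- For `t > 1` the kernel gives minus the integral over `[t, ∞)`, equal to the integral over
    -- `(-∞, t)` because `b` has total integral 0.
    · have hsplit := integral_add_compl (μ := dsOverS) (measurableSet_Iio (a := t)) hb
      rw [hb0, compl_Iio] at hsplit
      rw [eq_neg_of_add_eq_zero_left hsplit, ← integral_indicator measurableSet_Ici, smul_neg,
        ← integral_smul, ← integral_neg]
      refine integral_congr_ae (ae_of_all _ fun s => ?_)
      by_cases hs : t ≤ s <;> simp [B, κ, hs, ht, not_le.2 ht]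
  have hinner_t : ∀ᵐ s ∂dsOverS, ∫ t, B t s ∂dsOverS = (G s - G 1) • b s := by
    filter_upwards [ae_dsOverS_pos] with s hs0
    simp only [B]
    rw [integral_smul_const]
    congr 1
    rcases le_or_gt s 1 with hs | hs
    · rw [← hG s 1 hs0 hs, ← integral_indicator measurableSet_Ioc]
      refine integral_congr_ae (ae_of_all _ fun t => ?_)
      have h2 : ¬ (1 < t ∧ t ≤ s) := fun h => by linarith [h.1, h.2]
      by_cases ht : s < t ∧ t ≤ 1
      · simp [κ, ht]
      · simp only [κ, if_neg ht, if_neg h2, zero_mul]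
        rw [indicator_of_notMem (by simpa using ht)]
    · rw [← neg_sub, ← hG 1 s one_pos hs.le, ← integral_indicator measurableSet_Ioc,
        ← integral_neg]
      refine integral_congr_ae (ae_of_all _ fun t => ?_)
      have h2 : ¬ (s < t ∧ t ≤ 1) := fun h => by linarith [h.1, h.2]
      by_cases ht : 1 < t ∧ t ≤ s
      · simp [κ, ht, h2]
      · simp only [κ, if_neg ht, if_neg h2, zero_mul]
        rw [indicator_of_notMem (by simpa using ht), neg_zero]
  calc ∫ s, G s • b s ∂dsOverS
      = ∫ s, (G s - G 1) • b s ∂dsOverS := by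
        simp_rw [sub_smul]
        have hb1 : Integrable (fun s => G 1 • b s) dsOverS := hb.smul (G 1)
        rw [integral_sub hGb hb1, integral_smul, hb0, smul_zero, sub_zero]
    _ = ∫ s, ∫ t, B t s ∂dsOverS ∂dsOverS := (integral_congr_ae hinner_t).symm
    _ = ∫ t, ∫ s, B t s ∂dsOverS ∂dsOverS := (integral_integral_swap hBint).symm
    _ = _ := integral_congr_ae (ae_of_all _ hinner_s)

end Primitive

/-! ### Functions of polynomial growth in the logarithm. -/

section SlowGrowth

variable {𝕜 : Type v} [RCLike 𝕜]

/-- Measurable functions on `(0, ∞)` bounded by a power of `1 + |log s|`. -/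
structure SlowGrowth (γ : ℝ → 𝕜) : Prop where
  aestronglyMeasurable : AEStronglyMeasurable γ dsOverS
  exists_bound : ∃ (C : ℝ) (k : ℕ), 0 ≤ C ∧ ∀ᵐ s ∂dsOverS, ‖γ s‖ ≤ C * (1 + |Real.log s|) ^ k

namespace SlowGrowth

variable {γ δ : ℝ → 𝕜}

theorem of_bounded (h : AEStronglyMeasurable γ dsOverS) {C : ℝ} (hC : 0 ≤ C)
    (hle : ∀ᵐ s ∂dsOverS, ‖γ s‖ ≤ C) : SlowGrowth γ :=
  ⟨h, C, 0, hC, by simpa using hle⟩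

theorem const (c : 𝕜) : SlowGrowth fun _ : ℝ => c :=
  of_bounded aestronglyMeasurable_const (norm_nonneg c) (ae_of_all _ fun _ => le_rfl)

theorem mul (h : SlowGrowth γ) (h' : SlowGrowth δ) : SlowGrowth fun s => γ s * δ s := by
  obtain ⟨C, k, hC, hle⟩ := h.exists_bound
  obtain ⟨C', k', hC', hle'⟩ := h'.exists_bound
  refine ⟨h.aestronglyMeasurable.mul h'.aestronglyMeasurable, C * C', k + k', by positivity, ?_⟩
  filter_upwards [hle, hle'] with s h1 h2
  rw [norm_mul, pow_add]
  calc ‖γ s‖ * ‖δ s‖ ≤ (C * (1 + |Real.log s|) ^ k) * (C' * (1 + |Real.log s|) ^ k') :=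
        mul_le_mul h1 h2 (norm_nonneg _) (by positivity)
    _ = _ := by ring

theorem pow (h : SlowGrowth γ) (n : ℕ) : SlowGrowth fun s => γ s ^ n := by
  induction n with
  | zero => simpa using const (1 : 𝕜)
  | succ n ih => simpa [pow_succ] using ih.mul h

theorem add (h : SlowGrowth γ) (h' : SlowGrowth δ) : SlowGrowth fun s => γ s + δ s := by
  obtain ⟨C, k, hC, hle⟩ := h.exists_bound
  obtain ⟨C', k', hC', hle'⟩ := h'.exists_bound
  refine ⟨h.aestronglyMeasurable.add h'.aestronglyMeasurable, C + C', k + k', by positivity, ?_⟩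
  filter_upwards [hle, hle'] with s h1 h2
  have hone : 1 ≤ 1 + |Real.log s| := by linarith [abs_nonneg (Real.log s)]
  refine (norm_add_le _ _).trans ?_
  rw [add_mul]
  refine add_le_add (h1.trans ?_) (h2.trans ?_)
  · exact mul_le_mul_of_nonneg_left (pow_le_pow_right₀ hone (by omega)) hC
  · exact mul_le_mul_of_nonneg_left (pow_le_pow_right₀ hone (by omega)) hC'

theorem congr (h : SlowGrowth γ) (h' : ∀ᵐ s ∂dsOverS, γ s = δ s) : SlowGrowth δ := by
  obtain ⟨C, k, hC, hle⟩ := h.exists_bound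
  refine ⟨h.aestronglyMeasurable.congr h', C, k, hC, ?_⟩
  filter_upwards [hle, h'] with s h1 h2
  rwa [← h2]

theorem lintegral_lt_top (h : SlowGrowth γ) {θ : ℝ} (hθ₀ : 0 < θ) (hθ₁ : θ < 1) {q : ℝ≥0∞}
    (hq : 1 ≤ q) {F : ℝ → ℝ≥0∞}
    (hfin : eLpNorm (fun s => ENNReal.ofReal (s ^ (-θ)) * F s) q dsOverS < ∞) :
    ∫⁻ s, ‖γ s‖ₑ * (ENNReal.ofReal (min 1 (1 / s)) * F s) ∂dsOverS < ∞ := by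
  obtain ⟨C, k, hC, hle⟩ := h.exists_bound
  have h1 := ENNReal.mul_lt_top (ENNReal.ofReal_lt_top (r := C))
    (lintegral_log_pow_mul_lt_top hθ₀ hθ₁ hq hfin k)
  rw [← lintegral_const_mul' _ _ ENNReal.ofReal_ne_top] at h1
  refine lt_of_le_of_lt (lintegral_mono_ae ?_) h1
  filter_upwards [hle] with s hs
  rw [← mul_assoc, ← mul_assoc, ENNReal.ofReal_mul (by positivity), ← mul_assoc,
    ← ENNReal.ofReal_mul hC]
  refine mul_le_mul_left (mul_le_mul_left ?_ _) _
  rw [← ofReal_norm]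
  exact ENNReal.ofReal_le_ofReal hs

end SlowGrowth

variable {w : ℝ → 𝕜}

theorem MemW.aestronglyMeasurable_hardyP (hw : MemW w) :
    AEStronglyMeasurable (hardyP w) dsOverS :=
  (hw.continuousOn_hardyP.aestronglyMeasurable measurableSet_Ioi).mono_ac
    dsOverS_absolutelyContinuous

theorem MemW.aestronglyMeasurable_dsOverS (hw : MemW w) : AEStronglyMeasurable w dsOverS :=
  hw.aestronglyMeasurable.mono_ac dsOverS_absolutelyContinuous

theorem MemW.ae_dsOverS_norm_sub_le (hw : MemW w) :
    ∀ᵐ s ∂dsOverS, ‖hardyP w s - w s‖ ≤ (normW w).toReal :=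
  dsOverS_absolutelyContinuous.ae_le hw.ae_norm_sub_le

theorem MemW.slowGrowth_hardyP (hw : MemW w) : SlowGrowth (hardyP w) := by
  refine ⟨hw.aestronglyMeasurable_hardyP, ‖hardyP w 1‖ + (normW w).toReal, 1, by positivity, ?_⟩
  filter_upwards [ae_dsOverS_pos] with s hs
  have h1 := hw.norm_hardyP_sub_le hs
  have h2 := norm_le_norm_add_norm_sub' (hardyP w s) (hardyP w 1)
  have h3 : 0 ≤ ‖hardyP w 1‖ * |Real.log s| := by positivity
  have h4 : 0 ≤ (normW w).toReal := ENNReal.toReal_nonneg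
  nlinarith

theorem MemW.slowGrowth_sub (hw : MemW w) : SlowGrowth fun s => hardyP w s - w s :=
  SlowGrowth.of_bounded (hw.aestronglyMeasurable_hardyP.sub hw.aestronglyMeasurable_dsOverS)
    ENNReal.toReal_nonneg hw.ae_dsOverS_norm_sub_le

theorem MemW.slowGrowth_of_perturbation (hw : MemW w) {g : ℝ → 𝕜}
    (hg : AEStronglyMeasurable g dsOverS)
    (hgw : ∀ᵐ s ∂dsOverS, ‖g s - hardyP w s‖ ≤ (normW w).toReal) : SlowGrowth g :=
  (hw.slowGrowth_hardyP.add (SlowGrowth.of_bounded (hg.sub hw.aestronglyMeasurable_hardyP)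
    ENNReal.toReal_nonneg hgw)).congr (ae_of_all _ fun s => by simp)

theorem MemW.setIntegral_Ioc_pow (hw : MemW w) (j : ℕ) {x y : ℝ} (hx : 0 < x) (hxy : x ≤ y) :
    ∫ t in Ioc x y, (hardyP w t ^ j / (j.factorial : 𝕜)) * (hardyP w t - w t) ∂dsOverS =
      hardyP w x ^ (j + 1) / ((j + 1).factorial : 𝕜) -
        hardyP w y ^ (j + 1) / ((j + 1).factorial : 𝕜) := by
  rw [setIntegral_dsOverS measurableSet_Ioc (fun t ht => hx.trans ht.1), ← neg_sub,
    ← hw.integral_deriv_pow hx (hx.trans_le hxy) j, intervalIntegral.integral_of_le hxy,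
    ← integral_neg]
  refine integral_congr_ae (ae_of_all _ fun t => ?_)
  simp only
  rw [← neg_sub (w t), mul_neg, smul_neg]

end SlowGrowth

namespace BanachPair

variable {𝕜 : Type v} [RCLike 𝕜]

/-! ### The sum, the intersection and the functional `J`. -/

section Sum

variable (X : BanachPair.{u, v} 𝕜)

theorem norm_addMap_le (p : X.X₀ × X.X₁) : ‖X.addMap p‖ ≤ ‖p‖ :=
  Submodule.Quotient.norm_mk_le X.sumKer p

theorem norm_incl₀_le (x : X.X₀) : ‖X.incl₀ x‖ ≤ ‖x‖ := by
  simpa [incl₀, Prod.norm_def] using X.norm_addMap_le (x, 0)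

theorem norm_incl₁_le (x : X.X₁) : ‖X.incl₁ x‖ ≤ ‖x‖ := by
  simpa [incl₁, Prod.norm_def] using X.norm_addMap_le (0, x)

/-- The inclusion of `X₀` in `X₀ + X₁` as a continuous linear map. -/
def inclL₀ : X.X₀ →L[𝕜] X.Sum :=
  X.incl₀.mkContinuous 1 fun x => by simpa using X.norm_incl₀_le x

/-- The inclusion of `X₁` in `X₀ + X₁` as a continuous linear map. -/
def inclL₁ : X.X₁ →L[𝕜] X.Sum :=
  X.incl₁.mkContinuous 1 fun x => by simpa using X.norm_incl₁_le x

theorem incl₀_eq_incl₁_iff (x : X.X₀) (y : X.X₁) : X.incl₀ x = X.incl₁ y ↔ X.i₀ x = X.i₁ y := by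
  rw [← sub_eq_zero]
  have e : X.incl₀ x - X.incl₁ y = X.addMap (x, -y) := by
    simp only [incl₀, incl₁, LinearMap.comp_apply, ← map_sub]
    simp
  have hker : X.addMap (x, -y) = 0 ↔ (x, -y) ∈ X.sumKer :=
    Submodule.Quotient.mk_eq_zero (p := X.sumKer)
  rw [e, hker, LinearMap.mem_ker]
  simp [← sub_eq_add_neg, sub_eq_zero]

theorem inclInter_eq_incl₀ (x : X.Inter) : X.inclInter x = X.incl₀ x.1.1 := rfl

theorem inclInter_eq_incl₁ (x : X.Inter) : X.inclInter x = X.incl₁ x.1.2 :=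
  (X.incl₀_eq_incl₁_iff _ _).2 x.2

theorem addMap_eq (p : X.X₀ × X.X₁) : X.addMap p = X.incl₀ p.1 + X.incl₁ p.2 := by
  simp only [incl₀, incl₁, LinearMap.comp_apply, ← map_add]
  simp

theorem continuous_inclInter : Continuous X.inclInter :=
  X.inclL₀.continuous.comp (continuous_fst.comp continuous_subtype_val)

end Sum

section J

variable (X : BanachPair.{u, v} 𝕜)

theorem J_nonneg (t : ℝ) (x : X.Inter) : 0 ≤ X.J t x := (norm_nonneg _).trans (le_max_left _ _)

theorem J_add_le {t : ℝ} (ht : 0 ≤ t) (x y : X.Inter) : X.J t (x + y) ≤ X.J t x + X.J t y := by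
  refine max_le ?_ ?_
  · exact (norm_add_le _ _).trans (add_le_add (le_max_left _ _) (le_max_left _ _))
  · refine (mul_le_mul_of_nonneg_left (norm_add_le _ _) ht).trans ?_
    rw [mul_add]
    exact add_le_add (le_max_right _ _) (le_max_right _ _)

theorem J_smul (t : ℝ) (c : 𝕜) (x : X.Inter) : X.J t (c • x) = ‖c‖ * X.J t x := by
  rw [J, J, mul_max_of_nonneg _ _ (norm_nonneg c)]
  congr 1
  · exact norm_smul _ _
  · have : ‖(c • x).1.2‖ = ‖c‖ * ‖x.1.2‖ := norm_smul _ _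
    rw [this]
    ring

/-- The norm in the sum is at most that of either space; the better of the two gives the factor `min
{1, 1/s}`. -/
theorem norm_inclInter_le {s : ℝ} (hs : 0 < s) (x : X.Inter) :
    ‖X.inclInter x‖ ≤ min 1 (1 / s) * X.J s x := by
  rw [min_mul_of_nonneg _ _ (X.J_nonneg s x)]
  refine le_min ?_ ?_
  · rw [one_mul, inclInter_eq_incl₀]
    exact (X.norm_incl₀_le _).trans (le_max_left _ _)
  · rw [inclInter_eq_incl₁, one_div, ← div_eq_inv_mul, le_div_iff₀ hs, mul_comm]
    exact (mul_le_mul_of_nonneg_left (X.norm_incl₁_le _) hs.le).trans (le_max_right _ _)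

theorem aestronglyMeasurable_J {a : ℝ → X.Inter} (ha : AEStronglyMeasurable a dsOverS) :
    AEStronglyMeasurable (fun s => X.J s (a s)) dsOverS := by
  have h : AEStronglyMeasurable (fun s => (a s).1) dsOverS :=
    continuous_subtype_val.comp_aestronglyMeasurable ha
  exact h.fst.norm.sup (aestronglyMeasurable_id.mul h.snd.norm)

end J

/-- The functions `a : (0, ∞) → X₀ ∩ X₁` with `Φ_{θ,q}(J(s, a(s))) ≤ A`. -/
structure PhiBound (X : BanachPair.{u, v} 𝕜) (θ : ℝ) (q : ℝ≥0∞) (a : ℝ → X.Inter) (A : ℝ≥0∞) :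
    Prop where
  aestronglyMeasurable : AEStronglyMeasurable a dsOverS
  phi_le : Phi θ q (fun s => X.J s (a s)) ≤ A

/-! ### Calculus of functions with finite `Φ_{θ,q}(J)`. -/

section PhiBound

variable {X : BanachPair.{u, v} 𝕜} {θ : ℝ} {q : ℝ≥0∞} {a b : ℝ → X.Inter} {A B : ℝ≥0∞}

theorem phi_eq_eLpNorm_enorm (X : BanachPair.{u, v} 𝕜) (θ : ℝ) (q : ℝ≥0∞) (a : ℝ → X.Inter) :
    Phi θ q (fun s => X.J s (a s)) =
      eLpNorm (fun s => ENNReal.ofReal (s ^ (-θ)) * ENNReal.ofReal (X.J s (a s))) q dsOverS := by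
  refine eLpNorm_congr_enorm_ae ?_
  filter_upwards [ae_dsOverS_pos] with s hs
  rw [enorm_mul, enorm_eq_self, Real.enorm_of_nonneg (Real.rpow_nonneg hs.le _),
    Real.enorm_of_nonneg (X.J_nonneg _ _)]

namespace PhiBound

theorem mono (h : X.PhiBound θ q a A) (hAB : A ≤ B) : X.PhiBound θ q a B :=
  ⟨h.aestronglyMeasurable, h.phi_le.trans hAB⟩

theorem zero : X.PhiBound θ q (fun _ => 0) 0 := by
  refine ⟨aestronglyMeasurable_const, le_of_eq ?_⟩
  have : (fun s : ℝ => s ^ (-θ) * X.J s 0) = fun _ => 0 := by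
    funext s
    simp [J]
  simp [Phi, this]

theorem add (hq : 1 ≤ q) (h : X.PhiBound θ q a A) (h' : X.PhiBound θ q b B) :
    X.PhiBound θ q (fun s => a s + b s) (A + B) := by
  refine ⟨h.aestronglyMeasurable.add h'.aestronglyMeasurable, ?_⟩
  have hm : Measurable fun s : ℝ => s ^ (-θ) := by fun_prop
  refine le_trans ?_ ((eLpNorm_add_le
    (hm.aestronglyMeasurable.mul (X.aestronglyMeasurable_J h.aestronglyMeasurable))
    (hm.aestronglyMeasurable.mul (X.aestronglyMeasurable_J h'.aestronglyMeasurable)) hq).trans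
    (add_le_add h.phi_le h'.phi_le))
  refine eLpNorm_mono_ae ?_
  filter_upwards [ae_dsOverS_pos] with s hs
  have h0 : 0 ≤ s ^ (-θ) := Real.rpow_nonneg hs.le _
  simp only [Pi.add_apply, Pi.mul_apply]
  rw [← mul_add, Real.norm_of_nonneg (mul_nonneg h0 (X.J_nonneg _ _)),
    Real.norm_of_nonneg (mul_nonneg h0 (add_nonneg (X.J_nonneg _ _) (X.J_nonneg _ _)))]
  exact mul_le_mul_of_nonneg_left (X.J_add_le hs.le _ _) h0

theorem smul {ψ : ℝ → 𝕜} (hψ : AEStronglyMeasurable ψ dsOverS) {M : ℝ≥0∞} (hM : M ≠ ∞)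
    (hle : ∀ᵐ s ∂dsOverS, ‖ψ s‖ ≤ M.toReal) (h : X.PhiBound θ q a A) :
    X.PhiBound θ q (fun s => ψ s • a s) (M * A) := by
  refine ⟨hψ.smul h.aestronglyMeasurable, ?_⟩
  rw [← ENNReal.ofReal_toReal hM]
  refine (eLpNorm_le_mul_eLpNorm_of_ae_le_mul (g := fun s => s ^ (-θ) * X.J s (a s)) ?_ q).trans
    (mul_le_mul_right h.phi_le _)
  filter_upwards [hle] with s hs
  rw [J_smul, norm_mul, norm_mul, norm_mul, norm_norm]
  calc ‖s ^ (-θ)‖ * (‖ψ s‖ * ‖X.J s (a s)‖) = ‖ψ s‖ * (‖s ^ (-θ)‖ * ‖X.J s (a s)‖) := by ring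
    _ ≤ _ := mul_le_mul_of_nonneg_right hs (by positivity)

theorem neg (h : X.PhiBound θ q a A) : X.PhiBound θ q (fun s => -a s) A := by
  have h1 := h.smul (ψ := fun _ => (-1 : 𝕜)) (M := 1) aestronglyMeasurable_const
    ENNReal.one_ne_top (ae_of_all _ fun _ => by simp)
  rw [one_mul] at h1
  have e : (fun s => (-1 : 𝕜) • a s) = fun s => -a s := funext fun s => neg_one_smul 𝕜 (a s)
  rwa [e] at h1

theorem sum (hq : 1 ≤ q) {ι : Type*} (S : Finset ι) {a : ι → ℝ → X.Inter} {A : ι → ℝ≥0∞}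
    (h : ∀ i ∈ S, X.PhiBound θ q (a i) (A i)) :
    X.PhiBound θ q (fun s => ∑ i ∈ S, a i s) (∑ i ∈ S, A i) := by
  classical
  induction S using Finset.induction_on with
  | empty => simpa using zero
  | insert i S hi ih =>
    simp only [Finset.sum_insert hi]
    exact (h i (Finset.mem_insert_self i S)).add hq
      (ih fun j hj => h j (Finset.mem_insert_of_mem hj))

theorem eLpNorm_lt_top (h : X.PhiBound θ q a A) (hA : A ≠ ∞) :
    eLpNorm (fun s => ENNReal.ofReal (s ^ (-θ)) * ENNReal.ofReal (X.J s (a s))) q dsOverS < ∞ := by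
  rw [← phi_eq_eLpNorm_enorm]
  exact h.phi_le.trans_lt hA.lt_top

theorem aestronglyMeasurable_inclInter (h : X.PhiBound θ q a A) :
    AEStronglyMeasurable (fun s => X.inclInter (a s)) dsOverS :=
  X.continuous_inclInter.comp_aestronglyMeasurable h.aestronglyMeasurable

theorem _root_.BanachPair.enorm_inclInter_le (X : BanachPair.{u, v} 𝕜) {s : ℝ} (hs : 0 < s)
    (x : X.Inter) :
    ‖X.inclInter x‖ₑ ≤ ENNReal.ofReal (min 1 (1 / s)) * ENNReal.ofReal (X.J s x) := by
  rw [← ofReal_norm, ← ENNReal.ofReal_mul (le_min zero_le_one (by positivity))]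
  exact ENNReal.ofReal_le_ofReal (X.norm_inclInter_le hs x)

theorem integrable_smul (h : X.PhiBound θ q a A) (hA : A ≠ ∞) (hθ₀ : 0 < θ) (hθ₁ : θ < 1)
    (hq : 1 ≤ q) {γ : ℝ → 𝕜} (hγ : SlowGrowth γ) :
    Integrable (fun s => γ s • X.inclInter (a s)) dsOverS := by
  have hm : AEStronglyMeasurable (fun s => γ s • X.inclInter (a s)) dsOverS :=
    hγ.aestronglyMeasurable.fun_smul h.aestronglyMeasurable_inclInter
  refine ⟨hm, ?_⟩
  refine lt_of_le_of_lt (lintegral_mono_ae ?_)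
    (hγ.lintegral_lt_top hθ₀ hθ₁ hq (h.eLpNorm_lt_top hA))
  filter_upwards [ae_dsOverS_pos] with s hs
  rw [enorm_smul]
  exact mul_le_mul_right (X.enorm_inclInter_le hs _) _

theorem integrable (h : X.PhiBound θ q a A) (hA : A ≠ ∞) (hθ₀ : 0 < θ) (hθ₁ : θ < 1)
    (hq : 1 ≤ q) : Integrable (fun s => X.inclInter (a s)) dsOverS := by
  simpa using h.integrable_smul hA hθ₀ hθ₁ hq (SlowGrowth.const (1 : 𝕜))

theorem isRep (h : X.PhiBound θ q a A) (hA : A ≠ ∞) (hθ₀ : 0 < θ) (hθ₁ : θ < 1)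
    (hq : 1 ≤ q) : X.IsRep a (∫ s, X.inclInter (a s) ∂dsOverS) :=
  ⟨h.aestronglyMeasurable, h.integrable hA hθ₀ hθ₁ hq, rfl⟩

theorem integral_mem_interpSpace (h : X.PhiBound θ q a A) (hA : A ≠ ∞) (hθ₀ : 0 < θ) (hθ₁ : θ < 1)
    (hq : 1 ≤ q) : ∫ s, X.inclInter (a s) ∂dsOverS ∈ X.interpSpace θ q :=
  ⟨a, h.isRep hA hθ₀ hθ₁ hq, h.phi_le.trans_lt hA.lt_top⟩

theorem interpNorm_integral_le (h : X.PhiBound θ q a A) (hA : A ≠ ∞) (hθ₀ : 0 < θ) (hθ₁ : θ < 1)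
    (hq : 1 ≤ q) : X.interpNorm θ q (∫ s, X.inclInter (a s) ∂dsOverS) ≤ A :=
  (iInf₂_le a (h.isRep hA hθ₀ hθ₁ hq)).trans h.phi_le

end PhiBound

end PhiBound

/-! ### Primitives of functions with vanishing integral. -/

section Antiderivative

variable {X : BanachPair.{u, v} 𝕜} {θ : ℝ} {q : ℝ≥0∞} {a : ℝ → X.Inter} {A : ℝ≥0∞}

theorem setLIntegral_enorm_fst_le (a : ℝ → X.Inter) {t : ℝ} :
    ∫⁻ s in Iio t, ‖(a s).1.1‖ₑ ∂dsOverS ≤ calderon (fun s => ENNReal.ofReal (X.J s (a s))) t := by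
  rw [calderon, ← lintegral_indicator measurableSet_Iio]
  refine lintegral_mono_ae ?_
  filter_upwards [ae_dsOverS_pos] with s hs
  by_cases hst : s < t
  · rw [indicator_of_mem (by simpa using hst), min_eq_left ((le_div_iff₀ hs).2 (by linarith)),
      ENNReal.ofReal_one, one_mul, ← ofReal_norm]
    exact ENNReal.ofReal_le_ofReal (le_max_left _ _)
  · simp [hst]

/-- For `s ≥ t` the Calderón kernel is `t/s`, and `t ‖x‖ = (t/s) (s ‖x‖) ≤ (t/s) J(s, x)` for the
norm of `X₁`. -/
theorem setLIntegral_enorm_snd_le (a : ℝ → X.Inter) {t : ℝ} (ht : 0 < t) :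
    ENNReal.ofReal t * ∫⁻ s in Ici t, ‖(a s).1.2‖ₑ ∂dsOverS ≤
      calderon (fun s => ENNReal.ofReal (X.J s (a s))) t := by
  rw [calderon, ← lintegral_indicator measurableSet_Ici,
    ← lintegral_const_mul' _ _ ENNReal.ofReal_ne_top]
  refine lintegral_mono_ae ?_
  filter_upwards [ae_dsOverS_pos] with s hs
  by_cases hst : t ≤ s
  · rw [indicator_of_mem (by simpa using hst), min_eq_right ((div_le_iff₀ hs).2 (by linarith)),
      ← ofReal_norm, ← ENNReal.ofReal_mul ht.le, ← ENNReal.ofReal_mul (by positivity)]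
    refine ENNReal.ofReal_le_ofReal ?_
    calc t * ‖(a s).1.2‖ = t / s * (s * ‖(a s).1.2‖) := by field_simp
      _ ≤ t / s * X.J s (a s) := mul_le_mul_of_nonneg_left (le_max_right _ _) (by positivity)
  · simp [hst]

/-- If `∫ a(s) ds/s = 0`, the primitive `t ↦ ∫₀ᵗ a(s) ds/s = -∫ₜ^∞ a(s) ds/s` takes its values in
`X₀ ∩ X₁` and is controlled by the Calderón operator. -/
theorem PhiBound.exists_primitive (h : X.PhiBound θ q a A) (hA : A ≠ ∞) (hθ₀ : 0 < θ)
    (hθ₁ : θ < 1) (hq : 1 ≤ q) (h0 : ∫ s, X.inclInter (a s) ∂dsOverS = 0) :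
    ∃ V : ℝ → X.Inter, X.PhiBound θ q V (calderonConst θ * A) ∧
      ∀ t, 0 < t → X.inclInter (V t) = ∫ s in Iio t, X.inclInter (a s) ∂dsOverS := by
  classical
  let _ : NormedSpace ℝ X.X₀ := NormedSpace.restrictScalars ℝ 𝕜 X.X₀
  let _ : NormedSpace ℝ X.X₁ := NormedSpace.restrictScalars ℝ 𝕜 X.X₁
  set F : ℝ → ℝ≥0∞ := fun s => ENNReal.ofReal (X.J s (a s)) with hF
  have hFm : AEMeasurable F dsOverS :=
    (X.aestronglyMeasurable_J h.aestronglyMeasurable).aemeasurable.ennreal_ofReal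
  have hval : AEStronglyMeasurable (fun s => (a s).1) dsOverS :=
    continuous_subtype_val.comp_aestronglyMeasurable h.aestronglyMeasurable
  have hm₀ : AEStronglyMeasurable (fun s => (a s).1.1) dsOverS := hval.fst
  have hm₁ : AEStronglyMeasurable (fun s => (a s).1.2) dsOverS := hval.snd
  have hfin : ∀ t, 0 < t → calderon F t < ∞ := fun t ht =>
    calderon_lt_top hθ₀ hθ₁ hq (h.eLpNorm_lt_top hA) ht
  have hint₀ : ∀ t, 0 < t → IntegrableOn (fun s => (a s).1.1) (Iio t) dsOverS := fun t ht =>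
    ⟨hm₀.restrict, (setLIntegral_enorm_fst_le a).trans_lt (hfin t ht)⟩
  have hint₁ : ∀ t, 0 < t → IntegrableOn (fun s => (a s).1.2) (Ici t) dsOverS := fun t ht =>
    ⟨hm₁.restrict, ENNReal.lt_top_of_mul_ne_top_right
      ((setLIntegral_enorm_snd_le a ht).trans_lt (hfin t ht)).ne (ENNReal.ofReal_pos.2 ht).ne'⟩
  -- Near 0 only the `X₀` norm is integrable, near infinity only the `X₁` norm. The two expressions
  -- agree in the sum because of `h0`.
  let P : ℝ → X.X₀ × X.X₁ := fun t =>
    (∫ s in Iio t, (a s).1.1 ∂dsOverS, -∫ s in Ici t, (a s).1.2 ∂dsOverS)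
  have hP₀ : ∀ t, 0 < t → X.incl₀ (P t).1 = ∫ s in Iio t, X.inclInter (a s) ∂dsOverS :=
    fun t ht => (X.inclL₀.integral_comp_comm (hint₀ t ht)).symm
  have hP₁ : ∀ t, 0 < t → X.incl₁ (P t).2 = -∫ s in Ici t, X.inclInter (a s) ∂dsOverS := by
    intro t ht
    simp_rw [inclInter_eq_incl₁]
    rw [map_neg]
    exact congrArg Neg.neg (X.inclL₁.integral_comp_comm (hint₁ t ht)).symm
  have hPmem : ∀ t, 0 < t → P t ∈ X.Inter := by
    intro t ht
    refine (X.incl₀_eq_incl₁_iff _ _).1 ?_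
    change X.incl₀ (P t).1 = X.incl₁ (P t).2
    rw [hP₀ t ht, hP₁ t ht]
    have hsplit := integral_add_compl (μ := dsOverS) (measurableSet_Iio (a := t))
      (h.integrable hA hθ₀ hθ₁ hq)
    rw [h0, compl_Iio] at hsplit
    exact eq_neg_of_add_eq_zero_left hsplit
  let V : ℝ → X.Inter := fun t => if ht : 0 < t then ⟨P t, hPmem t ht⟩ else 0
  have hV : ∀ t (ht : 0 < t), V t = ⟨P t, hPmem t ht⟩ := fun t ht => dif_pos ht
  -- Measurability in `t` comes from writing both components as partial integrals of functions on
  -- the product.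
  have hPm : AEStronglyMeasurable P dsOverS := by
    have e₀ : ∀ t, ∫ s in Iio t, (a s).1.1 ∂dsOverS =
        ∫ s, {p : ℝ × ℝ | p.2 < p.1}.indicator (fun p => (a p.2).1.1) (t, s) ∂dsOverS := fun t => by
      rw [← integral_indicator measurableSet_Iio]
      rfl
    have e₁ : ∀ t, ∫ s in Ici t, (a s).1.2 ∂dsOverS =
        ∫ s, {p : ℝ × ℝ | p.1 ≤ p.2}.indicator (fun p => (a p.2).1.2) (t, s) ∂dsOverS := fun t => by
      rw [← integral_indicator measurableSet_Ici]
      rfl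
    refine AEStronglyMeasurable.prodMk ?_ (AEStronglyMeasurable.neg ?_)
    · simp_rw [e₀]
      exact (hm₀.comp_snd.indicator
        (measurableSet_lt measurable_snd measurable_fst)).integral_prod_right'
    · simp_rw [e₁]
      exact (hm₁.comp_snd.indicator
        (measurableSet_le measurable_fst measurable_snd)).integral_prod_right'
  refine ⟨V, ⟨?_, ?_⟩, fun t ht => ?_⟩
  · rw [← Topology.IsEmbedding.subtypeVal.aestronglyMeasurable_comp_iff]
    refine hPm.congr ?_
    filter_upwards [ae_dsOverS_pos] with t ht
    rw [hV t ht]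
  · rw [phi_eq_eLpNorm_enorm]
    refine le_trans (eLpNorm_mono_enorm_ae ?_) ((eLpNorm_calderon_le hθ₀ hθ₁ hq hFm).trans
      (mul_le_mul_right ((phi_eq_eLpNorm_enorm X θ q a).symm.le.trans h.phi_le) _))
    filter_upwards [ae_dsOverS_pos] with t ht
    rw [enorm_eq_self, enorm_eq_self]
    refine mul_le_mul_right ?_ _
    rw [hV t ht, J, ENNReal.ofReal_max]
    refine max_le ?_ ?_
    · rw [ofReal_norm]
      exact (enorm_integral_le_lintegral_enorm _).trans (setLIntegral_enorm_fst_le a)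
    · rw [ENNReal.ofReal_mul ht.le, ofReal_norm]
      simp only [P, enorm_neg]
      exact (mul_le_mul_right (enorm_integral_le_lintegral_enorm _) _).trans
        (setLIntegral_enorm_snd_le a ht)
  · rw [hV t ht, inclInter_eq_incl₀]
    exact hP₀ t ht

/-- The cancellation step: if `∫ a(s) ds/s = 0`, then integrating `a` against a power of `Pw`
amounts to integrating its primitive against `Pw - w` times a lower power. -/
theorem PhiBound.exists_cancellation (h : X.PhiBound θ q a A) (hA : A ≠ ∞) (hθ₀ : 0 < θ)
    (hθ₁ : θ < 1) (hq : 1 ≤ q) (h0 : ∫ s, X.inclInter (a s) ∂dsOverS = 0) {w : ℝ → 𝕜}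
    (hw : MemW w) :
    ∃ V : ℝ → X.Inter, X.PhiBound θ q V (normW w * (calderonConst θ * A)) ∧
      ∀ j : ℕ, ∫ s, (hardyP w s ^ (j + 1) / ((j + 1).factorial : 𝕜)) • X.inclInter (a s) ∂dsOverS =
        ∫ s, (hardyP w s ^ j / (j.factorial : 𝕜)) • X.inclInter (V s) ∂dsOverS := by
  obtain ⟨V, hV, hVeq⟩ := h.exists_primitive hA hθ₀ hθ₁ hq h0
  refine ⟨fun s => (hardyP w s - w s) • V s,
    hV.smul hw.slowGrowth_sub.aestronglyMeasurable hw.2.2.ne hw.ae_dsOverS_norm_sub_le,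
    fun j => ?_⟩
  have hpow : ∀ k : ℕ, SlowGrowth fun s => hardyP w s ^ k / (k.factorial : 𝕜) := fun k => by
    simpa [div_eq_mul_inv] using (hw.slowGrowth_hardyP.pow k).mul (SlowGrowth.const _)
  have hγ := (hpow j).mul hw.slowGrowth_sub
  have hFm : AEMeasurable (fun s => ENNReal.ofReal (X.J s (a s))) dsOverS :=
    (X.aestronglyMeasurable_J h.aestronglyMeasurable).aemeasurable.ennreal_ofReal
  -- Here `G = (Pw)^{j+1}/(j+1)!`, for which `-t G' = (Pw)^j/j! · (Pw - w)` almost everywhere.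
  rw [integral_smul_eq_integral_smul_primitive
    (γ := fun s => hardyP w s ^ j / (j.factorial : 𝕜) * (hardyP w s - w s))
    (F := fun s => ENNReal.ofReal (X.J s (a s)))
    (h.integrable hA hθ₀ hθ₁ hq) h0 (h.integrable_smul hA hθ₀ hθ₁ hq (hpow (j + 1)))
    hγ.aestronglyMeasurable (fun x y hx hxy => hw.setIntegral_Ioc_pow j hx hxy)]
  · refine integral_congr_ae ?_
    filter_upwards [ae_dsOverS_pos] with t ht
    rw [← hVeq t ht, map_smul, smul_smul]
  · filter_upwards [ae_dsOverS_pos] with s hs using X.enorm_inclInter_le hs _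
  · refine hγ.lintegral_lt_top hθ₀ hθ₁ hq ((eLpNorm_calderon_le hθ₀ hθ₁ hq hFm).trans_lt ?_)
    exact ENNReal.mul_lt_top (calderonConst_ne_top θ).lt_top (h.eLpNorm_lt_top hA)

end Antiderivative

end BanachPair

open Finset.HasAntidiagonal (antidiagonal antidiagonal.fst_le)

/-! ### Divided powers and exponential series. -/

section Binomial

variable {𝕜 : Type v} [RCLike 𝕜]

theorem add_pow_div_factorial (x y : 𝕜) (r : ℕ) :
    (x + y) ^ r / (r.factorial : 𝕜) = ∑ p ∈ antidiagonal r,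
      (x ^ p.1 / (p.1.factorial : 𝕜)) * (y ^ p.2 / (p.2.factorial : 𝕜)) := by
  rw [(Commute.all x y).add_pow', Finset.sum_div]
  refine Finset.sum_congr rfl fun p hp => ?_
  have hp' : p.1 + p.2 = r := Finset.HasAntidiagonal.mem_antidiagonal.1 hp
  have h : ((r.choose p.1 : ℕ) : 𝕜) * p.1.factorial * p.2.factorial = r.factorial := by
    rw [← hp', Nat.choose_symm_add]
    exact_mod_cast Nat.add_choose_mul_factorial_mul_factorial p.1 p.2
  have h0 : ∀ k : ℕ, ((k.factorial : ℕ) : 𝕜) ≠ 0 := fun k => by exact_mod_cast k.factorial_ne_zero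
  have h1 := h0 p.1
  have h2 := h0 p.2
  have h3 := h0 r
  rw [nsmul_eq_mul, div_mul_div_comm, div_eq_div_iff h3 (mul_ne_zero h1 h2), ← h]
  ring

/-- Compares coefficients in `e^{xζ} (e^{yζ} Z(ζ)) = e^{(x+y)ζ} Z(ζ)`, where `Z` is the generating
series of `z`. -/
theorem sum_antidiagonal_exp_mul {M : Type*} [AddCommGroup M] [Module 𝕜 M] (x y : 𝕜) (z : ℕ → M)
    (m : ℕ) :
    ∑ p ∈ antidiagonal m, (x ^ p.2 / (p.2.factorial : 𝕜)) •
        ∑ r ∈ antidiagonal p.1, (y ^ r.2 / (r.2.factorial : 𝕜)) • z r.1 =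
      ∑ p ∈ antidiagonal m, ((x + y) ^ p.2 / (p.2.factorial : 𝕜)) • z p.1 := by
  simp_rw [add_comm x y, add_pow_div_factorial, Finset.sum_smul, Finset.smul_sum]
  rw [Finset.sum_sigma', Finset.sum_sigma']
  -- Both sides sum over triples of indices with sum `m`, grouped as `(k + l) + j` on the left and
  -- `k + (l + j)` on the right.
  refine Finset.sum_nbij' (fun t => ⟨(t.2.1, t.2.2 + t.1.2), (t.2.2, t.1.2)⟩)
    (fun t => ⟨(t.1.1 + t.2.1, t.2.2), (t.1.1, t.2.1)⟩) ?_ ?_ ?_ ?_ ?_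
  · rintro ⟨⟨i, j⟩, k, l⟩ h
    simp only [Finset.mem_sigma, Finset.HasAntidiagonal.mem_antidiagonal] at h ⊢
    exact ⟨by omega, trivial⟩
  · rintro ⟨⟨i, j⟩, k, l⟩ h
    simp only [Finset.mem_sigma, Finset.HasAntidiagonal.mem_antidiagonal] at h ⊢
    exact ⟨by omega, trivial⟩
  · rintro ⟨⟨i, j⟩, k, l⟩ h
    simp only [Finset.mem_sigma, Finset.HasAntidiagonal.mem_antidiagonal] at h ⊢
    obtain ⟨-, rfl⟩ := h
    rfl
  · rintro ⟨⟨i, j⟩, k, l⟩ h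
    simp only [Finset.mem_sigma, Finset.HasAntidiagonal.mem_antidiagonal] at h ⊢
    obtain ⟨-, rfl⟩ := h
    rfl
  · rintro ⟨⟨i, j⟩, k, l⟩ -
    simp only [smul_smul]
    rw [mul_comm]

end Binomial

namespace BanachPair

variable {𝕜 : Type v} [RCLike 𝕜]

/-! ### Sequences with vanishing convolved moments. -/

section Moment

variable {X : BanachPair.{u, v} 𝕜} {θ : ℝ} {q : ℝ≥0∞} {A B : ℝ≥0∞}

/-- The moment `(1/j!) ∫ a(s) g(s)^j ds/s`. -/
def moment (X : BanachPair.{u, v} 𝕜) (g : ℝ → 𝕜) (j : ℕ) (a : ℝ → X.Inter) : X.Sum :=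
  ∫ s, (g s ^ j / (j.factorial : 𝕜)) • X.inclInter (a s) ∂dsOverS

theorem moment_zero_left (g : ℝ → 𝕜) (a : ℝ → X.Inter) :
    X.moment g 0 a = ∫ s, X.inclInter (a s) ∂dsOverS := by
  simp [moment]

theorem moment_zero_right (g : ℝ → 𝕜) (j : ℕ) : X.moment g j (fun _ => 0) = 0 := by
  simp [moment]

theorem moment_neg (g : ℝ → 𝕜) (j : ℕ) (a : ℝ → X.Inter) :
    X.moment g j (fun s => -a s) = -X.moment g j a := by
  simp only [moment, map_neg, smul_neg]
  exact integral_neg _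

theorem _root_.SlowGrowth.pow_div_factorial {g : ℝ → 𝕜} (hg : SlowGrowth g) (j : ℕ) :
    SlowGrowth fun s => g s ^ j / (j.factorial : 𝕜) := by
  simpa [div_eq_mul_inv] using (hg.pow j).mul (SlowGrowth.const ((j.factorial : 𝕜)⁻¹))

theorem moment_add (hθ₀ : 0 < θ) (hθ₁ : θ < 1) (hq : 1 ≤ q) {g : ℝ → 𝕜} (hg : SlowGrowth g)
    (j : ℕ) {a b : ℝ → X.Inter} (ha : X.PhiBound θ q a A) (hA : A ≠ ∞) (hb : X.PhiBound θ q b B)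
    (hB : B ≠ ∞) : X.moment g j (fun s => a s + b s) = X.moment g j a + X.moment g j b := by
  simp only [moment, map_add, smul_add]
  exact integral_add (ha.integrable_smul hA hθ₀ hθ₁ hq (hg.pow_div_factorial j))
    (hb.integrable_smul hB hθ₀ hθ₁ hq (hg.pow_div_factorial j))

theorem sum_antidiagonal_ite_eq {M : Type*} [AddCommMonoid M] (φ : ℕ → M) (m : ℕ) :
    ∑ p ∈ antidiagonal m, (if p.1 = 0 then φ p.2 else 0) = φ m := by
  rw [Finset.sum_eq_single (0, m)]
  · simp
  · rintro ⟨i, j⟩ hp hne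
    rw [if_neg]
    rintro rfl
    simp only [Finset.HasAntidiagonal.mem_antidiagonal, zero_add] at hp
    exact hne (by rw [hp])
  · simp

theorem PhiBound.ite {a : ℝ → X.Inter} (P : Prop) [Decidable P] (h : P → X.PhiBound θ q a A) :
    X.PhiBound θ q (fun s => if P then a s else 0) (if P then A else 0) := by
  by_cases hP : P
  · simpa [hP] using h hP
  · simpa [hP] using PhiBound.zero

theorem moment_ite (g : ℝ → 𝕜) (j : ℕ) (P : Prop) [Decidable P] (a : ℝ → X.Inter) :
    X.moment g j (fun s => if P then a s else 0) = if P then X.moment g j a else 0 := by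
  by_cases hP : P
  · simp [hP]
  · simpa [hP] using moment_zero_right g j

/-- If the convolved moments of `a₀, a₁, …` against the powers of `Pw` vanish up to order `n - 1`,
the moment of order `n` is represented by a function with the same bound as `aₙ`. -/
theorem exists_rep_of_moments_eq_zero (hθ₀ : 0 < θ) (hθ₁ : θ < 1) (hq : 1 ≤ q) {w : ℝ → 𝕜}
    (hw : MemW w) (n : ℕ) : ∀ (a : ℕ → ℝ → X.Inter) (A : ℝ≥0∞), A ≠ ∞ →
      (∀ k ≤ n, X.PhiBound θ q (a k) (A * normW w ^ k)) →
      (∀ m < n, ∑ p ∈ antidiagonal m, X.moment (hardyP w) p.2 (a p.1) = 0) →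
      ∃ R : ℝ → X.Inter, X.PhiBound θ q R ((1 + calderonConst θ) ^ n * A * normW w ^ n) ∧
        ∑ p ∈ antidiagonal n, X.moment (hardyP w) p.2 (a p.1) =
          ∫ s, X.inclInter (R s) ∂dsOverS := by
  have hM : normW w ≠ ∞ := hw.2.2.ne
  have hK := calderonConst_ne_top θ
  induction n with
  | zero =>
    intro a A hA hbound _
    exact ⟨a 0, by simpa using hbound 0 le_rfl, by simp [moment_zero_left]⟩
  | succ n ih =>
    intro a A hA hbound hzero
    have h₀ : X.PhiBound θ q (a 0) A := by simpa using hbound 0 (Nat.zero_le _)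
    obtain ⟨V, hV, hVeq⟩ := h₀.exists_cancellation hA hθ₀ hθ₁ hq (by
      simpa [moment_zero_left] using hzero 0 (Nat.succ_pos n)) hw
    have hV_top : normW w * (calderonConst θ * A) ≠ ∞ :=
      ENNReal.mul_ne_top hM (ENNReal.mul_ne_top hK hA)
    -- `a 0` is dropped, the other terms move down by one index, and `V` carries all positive
    -- moments of `a 0` in its place.
    let a' : ℕ → ℝ → X.Inter := fun k s => a (k + 1) s + if k = 0 then V s else 0
    have hVk : ∀ k : ℕ, X.PhiBound θ q (fun s => if k = 0 then V s else 0)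
        (if k = 0 then normW w * (calderonConst θ * A) else 0) := fun k =>
      PhiBound.ite (k = 0) fun _ => hV
    have hshift : ∀ m ≤ n, ∑ p ∈ antidiagonal (m + 1), X.moment (hardyP w) p.2 (a p.1) =
        ∑ p ∈ antidiagonal m, X.moment (hardyP w) p.2 (a' p.1) := by
      intro m hm
      have hterm : ∀ p ∈ antidiagonal m, X.moment (hardyP w) p.2 (a' p.1) =
          X.moment (hardyP w) p.2 (a (p.1 + 1)) +
            if p.1 = 0 then X.moment (hardyP w) p.2 V else 0 := by
        intro p hp
        have hp1 : p.1 ≤ m := antidiagonal.fst_le hp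
        rw [← moment_ite]
        refine moment_add hθ₀ hθ₁ hq hw.slowGrowth_hardyP _ (hbound (p.1 + 1) (by omega))
          (ENNReal.mul_ne_top hA (ENNReal.pow_ne_top hM)) (hVk p.1) ?_
        split_ifs
        · exact hV_top
        · exact ENNReal.zero_ne_top
      rw [Finset.sum_congr rfl hterm, Finset.sum_add_distrib,
        sum_antidiagonal_ite_eq (fun j => X.moment (hardyP w) j V),
        Finset.Nat.sum_antidiagonal_succ, add_comm]
      congr 1
      exact hVeq m
    -- The new constant is attained at index 0, where `a 1` contributes `A ‖w‖_W` and `V`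
    -- contributes `‖w‖_W` times `calderonConst θ * A`.
    obtain ⟨R, hR, hReq⟩ := ih a' (A * normW w * (1 + calderonConst θ))
      (ENNReal.mul_ne_top (ENNReal.mul_ne_top hA hM)
        (ENNReal.add_ne_top.2 ⟨ENNReal.one_ne_top, hK⟩))
      (fun k hk => by
        refine ((hbound (k + 1) (by omega)).add hq (hVk k)).mono ?_
        rcases Nat.eq_zero_or_pos k with rfl | hk0
        · refine le_of_eq ?_
          simp only [zero_add, pow_one, if_true, pow_zero, mul_one]
          ring
        · rw [if_neg hk0.ne', add_zero]
          calc A * normW w ^ (k + 1) = A * normW w * 1 * normW w ^ k := by ring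
            _ ≤ _ := by gcongr; exact le_self_add)
      (fun m hm => by rw [← hshift m hm.le]; exact hzero (m + 1) (by omega))
    refine ⟨R, hR.mono (le_of_eq ?_), (hshift n le_rfl).trans hReq⟩
    ring

/-- The version of `exists_rep_of_moments_eq_zero` for bounded perturbations `g` of `Pw`. -/
theorem exists_rep_of_moments_eq_zero_of_perturbation (hθ₀ : 0 < θ) (hθ₁ : θ < 1) (hq : 1 ≤ q)
    {w : ℝ → 𝕜} (hw : MemW w) {g : ℝ → 𝕜} (hg : AEStronglyMeasurable g dsOverS)
    (hgw : ∀ᵐ s ∂dsOverS, ‖g s - hardyP w s‖ ≤ (normW w).toReal) (n : ℕ)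
    (a : ℕ → ℝ → X.Inter) (hA : A ≠ ∞)
    (hbound : ∀ k ≤ n, X.PhiBound θ q (a k) (A * normW w ^ k))
    (hzero : ∀ m < n, ∑ p ∈ antidiagonal m, X.moment g p.2 (a p.1) = 0) :
    ∃ R : ℝ → X.Inter,
      X.PhiBound θ q R ((1 + calderonConst θ) ^ n * ((n + 1) * A) * normW w ^ n) ∧
      ∑ p ∈ antidiagonal n, X.moment g p.2 (a p.1) =
        ∫ s, X.inclInter (R s) ∂dsOverS := by
  have hM : normW w ≠ ∞ := hw.2.2.ne
  have hh := hw.slowGrowth_hardyP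
  let ψ : ℝ → 𝕜 := fun s => g s - hardyP w s
  have hψm : AEStronglyMeasurable ψ dsOverS := hg.sub hh.aestronglyMeasurable
  have hψ : SlowGrowth ψ := SlowGrowth.of_bounded hψm ENNReal.toReal_nonneg hgw
  have hgs : SlowGrowth g := hw.slowGrowth_of_perturbation hg hgw
  have hψpow : ∀ l : ℕ, ∀ᵐ s ∂dsOverS,
      ‖ψ s ^ l / (l.factorial : 𝕜)‖ ≤ (normW w ^ l).toReal := by
    intro l
    filter_upwards [hgw] with s hs
    rw [ENNReal.toReal_pow, norm_div, norm_pow, RCLike.norm_natCast]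
    have h1 : (1 : ℝ) ≤ l.factorial := by exact_mod_cast l.factorial_pos
    exact (div_le_self (by positivity) h1).trans (pow_le_pow_left₀ (norm_nonneg _) hs l)
  -- The series `e^{zψ}` is multiplied into the generating series of `a`, so that only powers of
  -- `Pw` remain.
  let b : ℕ → ℝ → X.Inter := fun k s =>
    ∑ r ∈ antidiagonal k, (ψ s ^ r.2 / (r.2.factorial : 𝕜)) • a r.1 s
  have hAtop : ∀ k, A * normW w ^ k ≠ ∞ := fun k => ENNReal.mul_ne_top hA (ENNReal.pow_ne_top hM)
  -- The factor `n + 1` bounds the number `k + 1` of summands in `b k`, each of size `A ‖w‖_W^k`.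
  have hb : ∀ k ≤ n, X.PhiBound θ q (b k) ((n + 1) * A * normW w ^ k) := by
    intro k hk
    refine (PhiBound.sum hq (antidiagonal k)
      (A := fun r => normW w ^ r.2 * (A * normW w ^ r.1)) fun r hr =>
        (hbound r.1 ((antidiagonal.fst_le hr).trans hk)).smul
          (hψ.pow_div_factorial r.2).aestronglyMeasurable (ENNReal.pow_ne_top hM)
          (hψpow r.2)).mono ?_
    have hterm : ∀ r ∈ antidiagonal k,
        normW w ^ r.2 * (A * normW w ^ r.1) = A * normW w ^ k := by
      intro r hr
      rw [← Finset.HasAntidiagonal.mem_antidiagonal.1 hr, pow_add]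
      ring
    rw [Finset.sum_congr rfl hterm, Finset.sum_const, Finset.Nat.card_antidiagonal, nsmul_eq_mul,
      mul_assoc]
    gcongr
    push_cast
    gcongr
  have hbtop : ∀ k : ℕ, ((n : ℝ≥0∞) + 1) * A * normW w ^ k ≠ ∞ := fun k =>
    ENNReal.mul_ne_top (ENNReal.mul_ne_top (by norm_cast; exact ENNReal.natCast_ne_top _) hA)
      (ENNReal.pow_ne_top hM)
  have hmoments : ∀ m ≤ n, ∑ p ∈ antidiagonal m, X.moment (hardyP w) p.2 (b p.1) =
      ∑ p ∈ antidiagonal m, X.moment g p.2 (a p.1) := by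
    intro m hm
    simp only [moment]
    rw [← integral_finsetSum _ fun p hp => ?_, ← integral_finsetSum _ fun p hp => ?_]
    · refine integral_congr_ae (ae_of_all _ fun s => ?_)
      have h := sum_antidiagonal_exp_mul (hardyP w s) (ψ s) (fun k => X.inclInter (a k s)) m
      rw [show hardyP w s + ψ s = g s by simp [ψ]] at h
      simp only [b, map_sum, map_smul]
      exact h
    · exact (hbound p.1 ((antidiagonal.fst_le hp).trans hm)).integrable_smul (hAtop _)
        hθ₀ hθ₁ hq (hgs.pow_div_factorial p.2)
    · exact (hb p.1 ((antidiagonal.fst_le hp).trans hm)).integrable_smul (hbtop _)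
        hθ₀ hθ₁ hq (hh.pow_div_factorial p.2)
  obtain ⟨R, hR, hReq⟩ := exists_rep_of_moments_eq_zero hθ₀ hθ₁ hq hw n b ((n + 1) * A)
    (by simpa using hbtop 0) hb (fun m hm => by rw [hmoments m hm.le]; exact hzero m hm)
  exact ⟨R, hR, by rw [← hmoments n le_rfl, hReq]⟩

end Moment

/-! ### Bounded operators of pairs. -/

section Hom

variable {X : BanachPair.{u, v} 𝕜} {Y : BanachPair.{u', v} 𝕜} (T : X.Hom Y)

namespace Hom

theorem norm_T₀_apply_le (x : X.X₀) : ‖T.T₀ x‖ ≤ T.opNorm * ‖x‖ :=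
  (T.T₀.le_opNorm x).trans (mul_le_mul_of_nonneg_right
    (by exact_mod_cast le_max_left ‖T.T₀‖₊ ‖T.T₁‖₊) (norm_nonneg x))

theorem norm_T₁_apply_le (x : X.X₁) : ‖T.T₁ x‖ ≤ T.opNorm * ‖x‖ :=
  (T.T₁.le_opNorm x).trans (mul_le_mul_of_nonneg_right
    (by exact_mod_cast le_max_right ‖T.T₀‖₊ ‖T.T₁‖₊) (norm_nonneg x))

theorem onSum_addMap (p : X.X₀ × X.X₁) : T.onSum (X.addMap p) = Y.addMap (T.T₀ p.1, T.T₁ p.2) := by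
  rw [addMap_eq, addMap_eq, map_add, T.restrict₀, T.restrict₁]

/-- Continuity on the sum is not part of `Hom`. It follows by applying `T₀` and `T₁` to the
components of a nearly optimal decomposition, and it allows `T` to pass under the integral. -/
theorem norm_onSum_le (x : X.Sum) : ‖T.onSum x‖ ≤ T.opNorm * ‖x‖ := by
  refine le_of_forall_pos_le_add fun ε hε => ?_
  have hδ : 0 < ε / (T.opNorm + 1) := by positivity
  obtain ⟨p, hp, hlt⟩ := Submodule.Quotient.norm_mk_lt (S := X.sumKer) x hδ
  have hp' : X.addMap p = x := hp
  have hlt' : ‖p‖ ≤ ‖x‖ + ε / (T.opNorm + 1) := hlt.le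
  rw [← hp', onSum_addMap, hp']
  refine (Y.norm_addMap_le _).trans ?_
  have h1 : ‖(T.T₀ p.1, T.T₁ p.2)‖ ≤ T.opNorm * ‖p‖ :=
    max_le ((T.norm_T₀_apply_le _).trans (by gcongr; exact norm_fst_le p))
      ((T.norm_T₁_apply_le _).trans (by gcongr; exact norm_snd_le p))
  have h2 : (T.opNorm : ℝ) * (ε / (T.opNorm + 1)) ≤ ε := by
    rw [mul_div_assoc', div_le_iff₀ (by positivity)]
    nlinarith [T.opNorm.coe_nonneg]
  calc ‖(T.T₀ p.1, T.T₁ p.2)‖ ≤ T.opNorm * ‖p‖ := h1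
    _ ≤ T.opNorm * (‖x‖ + ε / (T.opNorm + 1)) := by gcongr
    _ ≤ T.opNorm * ‖x‖ + ε := by rw [mul_add]; gcongr

/-- The map `X₀ + X₁ → Y₀ + Y₁` of a bounded operator of pairs, as a continuous linear map. -/
def onSumL : X.Sum →L[𝕜] Y.Sum := T.onSum.mkContinuous T.opNorm T.norm_onSum_le

/-- The map `X₀ ∩ X₁ → Y₀ ∩ Y₁` of a bounded operator of pairs. -/
def onInter (x : X.Inter) : Y.Inter :=
  ⟨(T.T₀ x.1.1, T.T₁ x.1.2), (Y.incl₀_eq_incl₁_iff _ _).1 (by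
    change Y.incl₀ (T.T₀ x.1.1) = Y.incl₁ (T.T₁ x.1.2)
    rw [← T.restrict₀, ← T.restrict₁, ← inclInter_eq_incl₀, ← inclInter_eq_incl₁])⟩

theorem inclInter_onInter (x : X.Inter) : Y.inclInter (T.onInter x) = T.onSum (X.inclInter x) :=
  (T.restrict₀ x.1.1).symm

theorem continuous_onInter : Continuous T.onInter := by
  refine Continuous.subtype_mk ?_ _
  exact (T.T₀.continuous.comp (continuous_fst.comp continuous_subtype_val)).prodMk
    (T.T₁.continuous.comp (continuous_snd.comp continuous_subtype_val))

theorem J_onInter_le {s : ℝ} (hs : 0 < s) (x : X.Inter) :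
    Y.J s (T.onInter x) ≤ T.opNorm * X.J s x := by
  rw [J, J, mul_max_of_nonneg _ _ T.opNorm.coe_nonneg]
  refine max_le_max (T.norm_T₀_apply_le _) ?_
  calc s * ‖T.T₁ x.1.2‖ ≤ s * (T.opNorm * ‖x.1.2‖) := by
        gcongr
        exact T.norm_T₁_apply_le _
    _ = _ := by ring

theorem phiBound_onInter {θ : ℝ} {q : ℝ≥0∞} {a : ℝ → X.Inter} {A : ℝ≥0∞}
    (h : X.PhiBound θ q a A) : Y.PhiBound θ q (fun s => T.onInter (a s)) (T.opNorm * A) := by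
  refine ⟨T.continuous_onInter.comp_aestronglyMeasurable h.aestronglyMeasurable, ?_⟩
  rw [← ENNReal.ofReal_coe_nnreal]
  refine (eLpNorm_le_mul_eLpNorm_of_ae_le_mul (g := fun s => s ^ (-θ) * X.J s (a s)) ?_ q).trans
    (mul_le_mul_right h.phi_le _)
  filter_upwards [ae_dsOverS_pos] with s hs
  have h0 : 0 ≤ s ^ (-θ) := Real.rpow_nonneg hs.le _
  rw [Real.norm_of_nonneg (mul_nonneg h0 (Y.J_nonneg _ _)),
    Real.norm_of_nonneg (mul_nonneg h0 (X.J_nonneg _ _))]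
  calc s ^ (-θ) * Y.J s (T.onInter (a s)) ≤ s ^ (-θ) * (T.opNorm * X.J s (a s)) := by
        gcongr
        exact T.J_onInter_le hs _
    _ = _ := by ring

theorem onSum_moment {g : ℝ → 𝕜} {j : ℕ} {a : ℝ → X.Inter}
    (h : Integrable (fun s => (g s ^ j / (j.factorial : 𝕜)) • X.inclInter (a s)) dsOverS) :
    T.onSum (X.moment g j a) = Y.moment g j (fun s => T.onInter (a s)) := by
  have h1 := T.onSumL.integral_comp_comm h
  simp only [map_smul] at h1
  simp only [moment, inclInter_onInter]
  exact h1.symm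

end Hom

end Hom

/-! ### The commutators as moments. -/

section Commutator

variable {X : BanachPair.{u, v} 𝕜} {Y : BanachPair.{u', v} 𝕜} {θ : ℝ} {q : ℝ≥0∞}

theorem Omega_eq_moment (U : X.NearOptimal θ q) (n : ℕ) (g : ℝ → 𝕜) (f : X.Sum) :
    Omega U n g f = X.moment g n (U.rep f) := by
  rw [Omega, moment, ← integral_smul]
  simp only [smul_smul, div_eq_inv_mul]

theorem NearOptimal.phiBound (U : X.NearOptimal θ q) {f : X.Sum} (hf : f ∈ X.interpSpace θ q) :
    X.PhiBound θ q (U.rep f) (2 * X.interpNorm θ q f) :=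
  ⟨(U.isRep f hf).aestronglyMeasurable, U.phi_le f hf⟩

theorem Omega_zero (U : X.NearOptimal θ q) (g : ℝ → 𝕜) {f : X.Sum}
    (hf : f ∈ X.interpSpace θ q) : Omega U 0 g f = f := by
  rw [Omega_eq_moment, moment_zero_left, (U.isRep f hf).integral_eq]

theorem interpNorm_ne_top {f : X.Sum} (hf : f ∈ X.interpSpace θ q) : X.interpNorm θ q f ≠ ∞ := by
  obtain ⟨a, ha, hlt⟩ := hf
  exact ((iInf₂_le a ha).trans_lt hlt).ne

/-- Since `C_0 f = T f`, the term `Ω_n (T f)` is the missing summand `k = 0` of the sum; for `n = 0`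
the sum is empty and `Ω_0 f = f`. -/
theorem commutator_eq (T : X.Hom Y) (UX : X.NearOptimal θ q) (UY : Y.NearOptimal θ q)
    (g : ℝ → 𝕜) (n : ℕ) {f : X.Sum} (hf : f ∈ X.interpSpace θ q) :
    commutator T UX UY g n f = T.onSum (Omega UX n g f) -
      ∑ k ∈ Finset.range n, Omega UY (n - k) g (commutator T UX UY g k f) := by
  cases n with
  | zero => rw [commutator, Omega_zero UX g hf]; simp
  | succ n =>
    rw [commutator, Finset.sum_range_succ', sub_sub,
      add_comm (Omega UY (n + 1) g (T.onSum f)), commutator, Nat.sub_zero]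
    congr 2
    rw [← Finset.sum_range_reflect, Finset.sum_fin_eq_sum_range]
    refine Finset.sum_congr rfl fun j hj => ?_
    have hj' := Finset.mem_range.1 hj
    have e₁ : n + 1 - (n - 1 - j + 1) = j + 1 := by omega
    have e₂ : n - 1 - j + 1 = n - j := by omega
    rw [dif_pos hj', e₁, e₂]

/-- The commutator of order `n` is the convolved moment of order `n` of the functions
`[k = 0] T u_f - [k < n] u_{C_k f}`, whose lower moments vanish. -/
theorem commutator_bound_of_lower (hθ₀ : 0 < θ) (hθ₁ : θ < 1) (hq : 1 ≤ q) (T : X.Hom Y)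
    (UX : X.NearOptimal θ q) (UY : Y.NearOptimal θ q) {w : ℝ → 𝕜} (hw : MemW w) {g : ℝ → 𝕜}
    (hg : AEStronglyMeasurable g dsOverS)
    (hgw : ∀ᵐ s ∂dsOverS, ‖g s - hardyP w s‖ ≤ (normW w).toReal) (n : ℕ) {f : X.Sum}
    (hf : f ∈ X.interpSpace θ q) (c : ℝ≥0)
    (hlower : ∀ k < n, commutator T UX UY g k f ∈ Y.interpSpace θ q ∧
      Y.interpNorm θ q (commutator T UX UY g k f) ≤
        c * T.opNorm * normW w ^ k * X.interpNorm θ q f) :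
    commutator T UX UY g n f ∈ Y.interpSpace θ q ∧
      Y.interpNorm θ q (commutator T UX UY g n f) ≤
        (1 + calderonConst θ) ^ n * ((n + 1) * ((2 + 2 * c) * T.opNorm * X.interpNorm θ q f)) *
          normW w ^ n := by
  have hM : normW w ≠ ∞ := hw.2.2.ne
  have hN := interpNorm_ne_top hf
  have hgs : SlowGrowth g := hw.slowGrowth_of_perturbation hg hgw
  set C : ℕ → Y.Sum := fun k => commutator T UX UY g k f with hC
  let b : ℝ → Y.Inter := fun s => T.onInter (UX.rep f s)
  -- The index `k = n` is left out of the second term, so the moment of order `n` is `C_n f` instead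
  -- of 0.
  let a : ℕ → ℝ → Y.Inter := fun k s =>
    (if k = 0 then b s else 0) + if k < n then -UY.rep (C k) s else 0
  have hbB : Y.PhiBound θ q b (T.opNorm * (2 * X.interpNorm θ q f)) :=
    T.phiBound_onInter (UX.phiBound hf)
  have hbtop : (T.opNorm : ℝ≥0∞) * (2 * X.interpNorm θ q f) ≠ ∞ := by finiteness
  have h₁ : ∀ k : ℕ, Y.PhiBound θ q (fun s => if k = 0 then b s else 0)
      (if k = 0 then T.opNorm * (2 * X.interpNorm θ q f) else 0) := fun k =>
    PhiBound.ite (k = 0) fun _ => hbB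
  have h₂ : ∀ k : ℕ, Y.PhiBound θ q (fun s => if k < n then -UY.rep (C k) s else 0)
      (if k < n then 2 * Y.interpNorm θ q (C k) else 0) := fun k =>
    PhiBound.ite (k < n) fun hk => (UY.phiBound (hlower k hk).1).neg
  have h₁top : ∀ k : ℕ, (if k = 0 then T.opNorm * (2 * X.interpNorm θ q f) else 0) ≠ ∞ := by
    intro k
    split_ifs
    · exact hbtop
    · exact ENNReal.zero_ne_top
  have h₂top : ∀ k : ℕ, (if k < n then 2 * Y.interpNorm θ q (C k) else 0) ≠ ∞ := by
    intro k
    split_ifs with hk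
    · exact ENNReal.mul_ne_top (by norm_num) (interpNorm_ne_top (hlower k hk).1)
    · exact ENNReal.zero_ne_top
  have hbound : ∀ k ≤ n, Y.PhiBound θ q (a k)
      ((2 + 2 * c) * T.opNorm * X.interpNorm θ q f * normW w ^ k) := by
    intro k _
    refine ((h₁ k).add hq (h₂ k)).mono ?_
    -- The first 2 is the near-optimality of `u_f`, the factor `2c` that of `u_{C_k f}` combined
    -- with the bound for `C_k f`.
    have e : (2 + 2 * (c : ℝ≥0∞)) * T.opNorm * X.interpNorm θ q f * normW w ^ k =
        T.opNorm * (2 * X.interpNorm θ q f) * normW w ^ k +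
          2 * (c * T.opNorm * normW w ^ k * X.interpNorm θ q f) := by ring
    rw [e]
    refine add_le_add ?_ ?_
    · split_ifs with hk
      · simp [hk]
      · exact zero_le
    · split_ifs with hk
      · exact mul_le_mul_right (hlower k hk).2 _
      · exact zero_le
  have hconv : ∀ m, ∑ p ∈ antidiagonal m, Y.moment g p.2 (a p.1) =
      T.onSum (Omega UX m g f) -
        ∑ p ∈ antidiagonal m, if p.1 < n then Omega UY p.2 g (C p.1) else 0 := by
    intro m
    have hterm : ∀ p : ℕ × ℕ, Y.moment g p.2 (a p.1) =
        (if p.1 = 0 then Y.moment g p.2 b else 0) -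
          if p.1 < n then Omega UY p.2 g (C p.1) else 0 := by
      intro p
      have h := moment_add hθ₀ hθ₁ hq hgs p.2 (h₁ p.1) (h₁top p.1) (h₂ p.1) (h₂top p.1)
      rw [moment_ite, moment_ite, moment_neg, ← Omega_eq_moment] at h
      refine h.trans ?_
      split_ifs <;> simp [sub_eq_add_neg]
    rw [Finset.sum_congr rfl fun p _ => hterm p, Finset.sum_sub_distrib,
      sum_antidiagonal_ite_eq (fun j => Y.moment g j b), Omega_eq_moment, T.onSum_moment]
    exact (UX.phiBound hf).integrable_smul (ENNReal.mul_ne_top (by norm_num) hN) hθ₀ hθ₁ hq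
      (hgs.pow_div_factorial m)
  have hzero : ∀ m < n, ∑ p ∈ antidiagonal m, Y.moment g p.2 (a p.1) = 0 := by
    intro m hm
    -- The last summand, `k = m`, is `Ω_0 (C_m f) = C_m f`; the rest is the recursion.
    rw [hconv, Finset.Nat.sum_antidiagonal_eq_sum_range_succ
      (fun k j => if k < n then Omega UY j g (C k) else 0), Finset.sum_range_succ, Nat.sub_self,
      if_pos hm, Omega_zero UY g (hlower m hm).1, ← sub_sub, sub_eq_zero, hC,
      commutator_eq T UX UY g m hf]
    congr 1
    refine Finset.sum_congr rfl fun k hk => ?_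
    rw [if_pos ((Finset.mem_range.1 hk).trans hm)]
  have htop : ∑ p ∈ antidiagonal n, Y.moment g p.2 (a p.1) = C n := by
    rw [hconv, Finset.Nat.sum_antidiagonal_eq_sum_range_succ
      (fun k j => if k < n then Omega UY j g (C k) else 0), Finset.sum_range_succ,
      if_neg (lt_irrefl n), add_zero]
    refine Eq.trans ?_ (commutator_eq T UX UY g n hf).symm
    congr 1
    refine Finset.sum_congr rfl fun k hk => ?_
    rw [if_pos (Finset.mem_range.1 hk)]
  have hK := calderonConst_ne_top θ
  have hA : (2 + 2 * (c : ℝ≥0∞)) * T.opNorm * X.interpNorm θ q f ≠ ∞ := by finiteness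
  obtain ⟨R, hR, hReq⟩ := exists_rep_of_moments_eq_zero_of_perturbation hθ₀ hθ₁ hq hw hg hgw n a
    hA hbound hzero
  rw [htop] at hReq
  have hRtop : (1 + calderonConst θ) ^ n *
      ((n + 1) * ((2 + 2 * (c : ℝ≥0∞)) * T.opNorm * X.interpNorm θ q f)) * normW w ^ n ≠ ∞ := by
    finiteness
  change C n ∈ _ ∧ Y.interpNorm θ q (C n) ≤ _
  rw [hReq]
  exact ⟨hR.integral_mem_interpSpace hRtop hθ₀ hθ₁ hq,
    hR.interpNorm_integral_le hRtop hθ₀ hθ₁ hq⟩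

end Commutator

end BanachPair

/-! ### The induction on the order and the theorem. -/

theorem MemW.ae_norm_sub_hardyP_le_of_eq {𝕜 : Type v} [RCLike 𝕜] {w g : ℝ → 𝕜} (hw : MemW w)
    (hg : g = w ∨ g = hardyP w) :
    AEStronglyMeasurable g dsOverS ∧
      ∀ᵐ s ∂dsOverS, ‖g s - hardyP w s‖ ≤ (normW w).toReal := by
  rcases hg with rfl | rfl
  · refine ⟨hw.aestronglyMeasurable_dsOverS, ?_⟩
    filter_upwards [hw.ae_dsOverS_norm_sub_le] with s hs
    rwa [norm_sub_rev]
  · exact ⟨hw.aestronglyMeasurable_hardyP, ae_of_all _ fun s => by simp⟩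

theorem MemW.slowGrowth_of_eq {𝕜 : Type v} [RCLike 𝕜] {w g : ℝ → 𝕜} (hw : MemW w)
    (hg : g = w ∨ g = hardyP w) : SlowGrowth g := by
  obtain ⟨hm, hle⟩ := hw.ae_norm_sub_hardyP_le_of_eq hg
  exact hw.slowGrowth_of_perturbation hm hle

theorem exists_commutator_bound (𝕜 : Type v) [RCLike 𝕜] (n : ℕ) (θ : ℝ) (hθ₀ : 0 < θ)
    (hθ₁ : θ < 1) (q : ℝ≥0∞) (hq : 1 ≤ q) :
    ∃ c : ℝ≥0, ∀ (X : BanachPair.{u, v} 𝕜) (Y : BanachPair.{u', v} 𝕜) (T : X.Hom Y)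
      (UX : X.NearOptimal θ q) (UY : Y.NearOptimal θ q) (w : ℝ → 𝕜), MemW w →
      ∀ g : ℝ → 𝕜, (g = w ∨ g = hardyP w) →
        ∀ f ∈ X.interpSpace θ q,
          BanachPair.commutator T UX UY g n f ∈ Y.interpSpace θ q ∧
          Y.interpNorm θ q (BanachPair.commutator T UX UY g n f) ≤
            c * T.opNorm * normW w ^ n * X.interpNorm θ q f := by
  induction n using Nat.strong_induction_on with
  | _ n ih =>
    choose! c hc using ih
    -- The sum of the lower constants dominates each of them, so one `c` serves for all `k < n`.
    refine ⟨(1 + (calderonConst θ).toNNReal) ^ n * ((n + 1) *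
      (2 + 2 * ∑ k ∈ Finset.range n, c k)), fun X Y T UX UY w hw g hg f hf => ?_⟩
    obtain ⟨hm, hle⟩ := hw.ae_norm_sub_hardyP_le_of_eq hg
    obtain ⟨h1, h2⟩ := BanachPair.commutator_bound_of_lower hθ₀ hθ₁ hq T UX UY hw hm hle n hf
      (∑ k ∈ Finset.range n, c k) (fun k hk => by
        obtain ⟨h1, h2⟩ := hc k hk X Y T UX UY w hw g hg f hf
        refine ⟨h1, h2.trans ?_⟩
        gcongr
        exact Finset.single_le_sum (fun _ _ => zero_le) (Finset.mem_range.2 hk))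
    refine ⟨h1, h2.trans (le_of_eq ?_)⟩
    push_cast
    rw [ENNReal.coe_toNNReal (calderonConst_ne_top θ)]
    ring

end

theorem mainTheorem3 (𝕜 : Type v) [RCLike 𝕜] (n : ℕ) (θ : ℝ) (hθ₀ : 0 < θ) (hθ₁ : θ < 1)
    (q : ℝ≥0∞) (hq : 1 ≤ q) :
    ∃ c : ℝ≥0, ∀ (X : BanachPair.{u, v} 𝕜) (Y : BanachPair.{u', v} 𝕜) (T : X.Hom Y)
      (UX : X.NearOptimal θ q) (UY : Y.NearOptimal θ q) (w : ℝ → 𝕜), MemW w →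
      ∀ g : ℝ → 𝕜, (g = w ∨ g = hardyP w) →
        -- the integrals that define `Ω_{k,g}` converge in `X₀ + X₁` and in `Y₀ + Y₁`
        (∀ (k : ℕ), ∀ f ∈ X.interpSpace θ q,
          Integrable (fun s => (g s) ^ k • X.inclInter (UX.rep f s)) dsOverS) ∧
        (∀ (k : ℕ), ∀ f ∈ Y.interpSpace θ q,
          Integrable (fun s => (g s) ^ k • Y.inclInter (UY.rep f s)) dsOverS) ∧
        -- `C_{n,g}` maps the first interpolation space to the second, with the norm bound
        ∀ f ∈ X.interpSpace θ q,
          BanachPair.commutator T UX UY g n f ∈ Y.interpSpace θ q ∧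
          Y.interpNorm θ q (BanachPair.commutator T UX UY g n f) ≤
            c * T.opNorm * normW w ^ n * X.interpNorm θ q f := by
  obtain ⟨c, hc⟩ := exists_commutator_bound 𝕜 n θ hθ₀ hθ₁ q hq
  refine ⟨c, fun X Y T UX UY w hw g hg => ⟨fun k f hf => ?_, fun k f hf => ?_, ?_⟩⟩
  · exact (UX.phiBound hf).integrable_smul
      (ENNReal.mul_ne_top (by norm_num) (BanachPair.interpNorm_ne_top hf)) hθ₀ hθ₁ hq
      ((hw.slowGrowth_of_eq hg).pow k)
  · exact (UY.phiBound hf).integrable_smul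
      (ENNReal.mul_ne_top (by norm_num) (BanachPair.interpNorm_ne_top hf)) hθ₀ hθ₁ hq
      ((hw.slowGrowth_of_eq hg).pow k)
  · exact hc X Y T UX UY w hw g hg
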